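/- Let $\kappa,\sigma,\sigma_n,\Delta t>0$ and $\theta\in\mathbb R$. Let $\{X_t\}_{t\ge 0}$ be the Ornstein--Uhlenbeck process $dX_t=\kappa(\theta-X_t)\,dt+\sigma\,dW_t$ with $X_0\sim\mathcal N(\theta,\sigma^2/(2\kappa))$ independent of the standard Brownian motion $W$. It is sampled at the times $t_i=i\,\Delta t$; the $i$-th sample is received at a time $t'_i>t_i$ as $Y_{t'_i}=X_{t_i}+N_{t'_i}$, where the $N_{t'_i}$ are i.i.d. $\mathcal N(0,\sigma_n^2)$ and independent of $\{X_t\}$. For $2\le m\le n$ and $t>t'_n$ let $v(t)=I(X_t;Y_{t'_n},\dots,Y_{t'_{n-m+1}})$ be the value of information (mutual information in nats). Put $\gamma=\sigma^2/(2\kappa\sigma_n^2)$ and $\rho=e^{-\kappa\Delta t}$. Then $v(t)$ is finite and, as $1/\gamma\to 0$, $$v(t)=\frac12\log\frac{1}{1-e^{-2\kappa(t-t_n)}}-\frac12\log\Bigl[1+\frac{1}{e^{2\kappa(t-t_n)}-1}\Bigl(\frac1\gamma-\frac{1}{(1-\rho^2)\gamma^2}\Bigr)\Bigr]+O\Bigl(\frac1{\gamma^3}\Bigr).$$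 The approximating expression does not depend on $m$. The $O$ is uniform: there are $\gamma_0>0$ and $C\ge 0$, depending only on $\kappa$, $\Delta t$ and $t-t_n$ (in particular not on $m$, $n$), such that for $\gamma\ge\gamma_0$ the error is at most $C/\gamma^3$ in absolute value. -/

import Mathlib

open MeasureTheory ProbabilityTheory Set
open scoped NNReal ENNReal

noncomputable section

/-- Mutual information `I(U; V)` in nats: the Kullback-Leibler divergence of the joint law of
`(U, V)` from the product of the marginal laws. -/
def mutualInfo {Ω α β : Type*} [MeasurableSpace Ω] [MeasurableSpace α] [MeasurableSpace β]
    (U : Ω → α) (V : Ω → β) (P : Measure Ω) : ℝ≥0∞ :=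
  InformationTheory.klDiv (P.map fun ω ↦ (U ω, V ω)) ((P.map U).prod (P.map V))

/-- `X` is the Ornstein-Uhlenbeck process driven by the Brownian motion `W`: a solution with
continuous paths of the stochastic differential equation `dX = κ (θ - X) dt + σ dW`, started from
`X 0 ∼ 𝒩(θ, σ² / (2κ))` independent of `W`. As the diffusion coefficient is constant, the
stochastic integral of the equation is `σ W t` (recall `W 0 = 0` almost surely). -/
structure IsOUProcess {Ω : Type*} [MeasurableSpace Ω] (κ θ σ : ℝ) (X W : ℝ≥0 → Ω → ℝ)
    (P : Measure Ω) : Prop where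
  brownian : IsBrownianReal W P
  hasLaw_zero : HasLaw (X 0) (gaussianReal θ (σ ^ 2 / (2 * κ)).toNNReal) P
  indep_zero : IndepFun (X 0) (fun ω t ↦ W t ω) P
  continuous : ∀ᵐ ω ∂P, Continuous fun t ↦ X t ω
  sde : ∀ᵐ ω ∂P, ∀ t : ℝ≥0,
    X t ω = X 0 ω + (∫ s in (0 : ℝ)..t, κ * (θ - X s.toNNReal ω)) + σ * W t ω

/-- The values `N (t' i)` of the noise process at the receiving times `t' i` are independent
centred Gaussian variables of variance `σn²`, and they are independent of the process `X`. -/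
structure IsChannelNoise {Ω : Type*} [MeasurableSpace Ω] (σn : ℝ) (t' : ℕ → ℝ≥0)
    (X N : ℝ≥0 → Ω → ℝ) (P : Measure Ω) : Prop where
  hasLaw : ∀ i, HasLaw (N (t' i)) (gaussianReal 0 (σn ^ 2).toNNReal) P
  iIndep : iIndepFun (fun i ↦ N (t' i)) P
  indep : IndepFun (fun ω s ↦ X s ω) (fun ω i ↦ N (t' i) ω) P

/-- The observation `X (t i) + N (t' i)` that corresponds to the sample taken at time `t i` and
received at time `t' i`. -/
def observation {Ω : Type*} (t t' : ℕ → ℝ≥0) (X N : ℝ≥0 → Ω → ℝ) (i : ℕ) : Ω → ℝ :=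
  fun ω ↦ X (t i) ω + N (t' i) ω

/-- The value of information at time `s`: the mutual information between `X s` and the `m` most
recent of the observations with indices `1, …, n`, that is, those with indices
`n - m + 1, …, n` (for `1 ≤ m ≤ n`). -/
def valueOfInformation {Ω : Type*} [MeasurableSpace Ω] (t t' : ℕ → ℝ≥0) (X N : ℝ≥0 → Ω → ℝ)
    (P : Measure Ω) (m n : ℕ) (s : ℝ≥0) : ℝ≥0∞ :=
  mutualInfo (X s) (fun ω (j : Fin m) ↦ observation t t' X N (n - m + 1 + j) ω) P

/-- Uniform sampling: `t i = i Δt`. -/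
def uniformTime (Δt : ℝ≥0) (i : ℕ) : ℝ≥0 := i * Δt

/-- The ratio `γ` of the variance `σ² / (2κ)` of the process to the variance `σn²` of the noise. -/
def snr (κ σ σn : ℝ) : ℝ := σ ^ 2 / (2 * κ) / σn ^ 2

/-- The value of information of the directly observed Ornstein-Uhlenbeck process, when the latest
sample has age `τ`. -/
def markovTerm (κ τ : ℝ) : ℝ := 1 / 2 * Real.log (1 / (1 - Real.exp (-2 * κ * τ)))

/-- The correction of second order in `1 / γ`, with `ρ = exp (-κ Δt)`. -/
def highSNRCorrection (κ τ ρ γ : ℝ) : ℝ :=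
  1 / 2 * Real.log
    (1 + 1 / (Real.exp (2 * κ * τ) - 1) * (1 / γ - 1 / ((1 - ρ ^ 2) * γ ^ 2)))

end

/-!
By variation of constants the Ornstein-Uhlenbeck process is a pointwise limit of Riemann-Stieltjes
sums of its Brownian motion, hence a stationary Gaussian process whose covariance decays
exponentially. For jointly Gaussian variables the error of the linear estimate of `X s` is
independent of the observations, so the mutual information is half the logarithm of the quotient of
the variance of `X s` by the error variance. Exponential correlations are multiplicative along the
sampling times, so this error variance obeys the scalar Kalman recursion, in which the filter of one
noisy sample of noise variance `r` returns at most `r`. In units of the variance of the process the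
prediction variance of the last sample therefore lies between `1 - ρ ^ 2` and
`1 - ρ ^ 2 + ρ ^ 2 / γ`, whatever the earlier samples contribute, and this determines the second
order expansion uniformly in their number.
-/

section WienerIntegral

open Filter Topology

/-- The `i`-th point of the grid of mesh `1 / n`, stopped at `t`. Stopping, rather than rescaling,
lets the grids for different values of `t` share their points. -/
noncomputable def stoppedGrid (n : ℕ) (t : ℝ≥0) (i : ℕ) : ℝ≥0 := min (i / n) t

/-- The left Riemann-Stieltjes sum of `f` against `w` over `[0, t]`, on the grid of mesh `1 / n`
stopped at `t`; its `n ^ 2` steps cover `[0, t]` as soon as `t ≤ n`. -/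
noncomputable def stieltjesSum (f : ℝ → ℝ) (w : ℝ≥0 → ℝ) (n : ℕ) (t : ℝ≥0) : ℝ :=
  ∑ i ∈ Finset.range (n ^ 2), f (i / n) * (w (stoppedGrid n t (i + 1)) - w (stoppedGrid n t i))

/-- The integral of the continuously differentiable function `f` against `w` over `[0, t]`, defined
by integration by parts, so that it makes sense for paths `w` that are merely continuous. -/
noncomputable def wienerIntegral (f : ℝ → ℝ) (w : ℝ≥0 → ℝ) (t : ℝ≥0) : ℝ :=
  f t * w t - f 0 * w 0 - ∫ u in (0 : ℝ)..t, deriv f u * w u.toNNReal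

lemma stoppedGrid_zero (n : ℕ) (t : ℝ≥0) : stoppedGrid n t 0 = 0 := by simp [stoppedGrid]

lemma stoppedGrid_sq {n : ℕ} {t : ℝ≥0} (htn : t ≤ n) : stoppedGrid n t (n ^ 2) = t := by
  have : ((n ^ 2 : ℕ) : ℝ≥0) / n = n := by rw [Nat.cast_pow, sq, mul_self_div_self]
  rw [stoppedGrid, this, min_eq_right htn]

lemma stoppedGrid_le (n : ℕ) (t : ℝ≥0) (i : ℕ) : stoppedGrid n t i ≤ t := min_le_right _ _

lemma monotone_stoppedGrid (n : ℕ) (t : ℝ≥0) : Monotone (stoppedGrid n t) := fun i j hij ↦ by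
  unfold stoppedGrid; gcongr

lemma stoppedGrid_succ_le (n : ℕ) (t : ℝ≥0) (i : ℕ) :
    stoppedGrid n t (i + 1) ≤ stoppedGrid n t i + (n : ℝ≥0)⁻¹ := by
  rw [stoppedGrid, stoppedGrid, ← min_add_add_right, Nat.cast_succ, add_div, one_div]
  exact min_le_min_left _ le_self_add

lemma mul_sub_stoppedGrid (f : ℝ → ℝ) (w : ℝ≥0 → ℝ) (n : ℕ) (t : ℝ≥0) (i : ℕ) :
    f (i / n) * (w (stoppedGrid n t (i + 1)) - w (stoppedGrid n t i))
      = f (stoppedGrid n t i) * (w (stoppedGrid n t (i + 1)) - w (stoppedGrid n t i)) := by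
  rcases le_total ((i : ℝ≥0) / n) t with h | h
  · simp [stoppedGrid, min_eq_left (show (i / n : ℝ) ≤ t by exact_mod_cast h)]
  · have hi : stoppedGrid n t i = t := min_eq_right h
    have hi' : stoppedGrid n t (i + 1) = t :=
      (stoppedGrid_le n t _).antisymm (hi.ge.trans (monotone_stoppedGrid n t i.le_succ))
    simp [hi, hi']

lemma sum_integral_stoppedGrid {n : ℕ} {t : ℝ≥0} (htn : t ≤ n) {g : ℝ → ℝ} (hg : Continuous g) :
    ∑ i ∈ Finset.range (n ^ 2), ∫ u in (stoppedGrid n t i : ℝ)..stoppedGrid n t (i + 1), g u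
      = ∫ u in (0 : ℝ)..t, g u := by
  rw [intervalIntegral.sum_integral_adjacent_intervals (a := fun i ↦ (stoppedGrid n t i : ℝ))
    fun _ _ ↦ hg.intervalIntegrable _ _, stoppedGrid_zero, stoppedGrid_sq htn, NNReal.coe_zero]

lemma stieltjesSum_sub_wienerIntegral {f : ℝ → ℝ} {w : ℝ≥0 → ℝ} (hf : ContDiff ℝ 1 f)
    (hw : Continuous w) {n : ℕ} {t : ℝ≥0} (htn : t ≤ n) :
    stieltjesSum f w n t - wienerIntegral f w t = ∑ i ∈ Finset.range (n ^ 2),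
      ∫ u in (stoppedGrid n t i : ℝ)..stoppedGrid n t (i + 1),
        deriv f u * (w u.toNNReal - w (stoppedGrid n t (i + 1))) := by
  set p := stoppedGrid n t
  have hf' : Continuous (deriv f) := hf.continuous_deriv_one
  have hfw : Continuous fun u ↦ deriv f u * w u.toNNReal :=
    hf'.mul (hw.comp continuous_real_toNNReal)
  have hstep (i : ℕ) : ∫ u in (p i : ℝ)..p (i + 1), deriv f u * (w u.toNNReal - w (p (i + 1)))
      = (∫ u in (p i : ℝ)..p (i + 1), deriv f u * w u.toNNReal)
        - (f (p (i + 1)) - f (p i)) * w (p (i + 1)) := by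
    simp only [mul_sub]
    rw [intervalIntegral.integral_sub (hfw.intervalIntegrable _ _)
      ((hf'.mul_const _).intervalIntegrable _ _), intervalIntegral.integral_mul_const,
      intervalIntegral.integral_deriv_eq_sub (fun u _ ↦ hf.differentiable_one u)
        (hf'.intervalIntegrable _ _), sub_mul]
  have hboundary : f t * w t - f 0 * w 0
      = ∑ i ∈ Finset.range (n ^ 2), (f (p (i + 1)) * w (p (i + 1)) - f (p i) * w (p i)) := by
    rw [Finset.sum_range_sub (fun i ↦ f (p i) * w (p i)), show p 0 = 0 from stoppedGrid_zero n t,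
      show p (n ^ 2) = t from stoppedGrid_sq htn, NNReal.coe_zero]
  rw [wienerIntegral, hboundary, ← sum_integral_stoppedGrid htn hfw, stieltjesSum,
    ← Finset.sum_sub_distrib, ← Finset.sum_sub_distrib]
  refine Finset.sum_congr rfl fun i _ ↦ ?_
  rw [hstep, mul_sub_stoppedGrid]
  ring

lemma abs_stieltjesSum_sub_wienerIntegral_le {f : ℝ → ℝ} {w : ℝ≥0 → ℝ} (hf : ContDiff ℝ 1 f)
    (hw : Continuous w) {n : ℕ} {t : ℝ≥0} (htn : t ≤ n) {ε : ℝ}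
    (hε : ∀ u ≤ t, ∀ v ≤ t, dist u v ≤ (n : ℝ)⁻¹ → |w u - w v| ≤ ε) :
    |stieltjesSum f w n t - wienerIntegral f w t| ≤ ∫ u in (0 : ℝ)..t, ε * |deriv f u| := by
  have hbound : Continuous fun u ↦ ε * |deriv f u| := hf.continuous_deriv_one.abs.const_mul ε
  rw [stieltjesSum_sub_wienerIntegral hf hw htn, ← sum_integral_stoppedGrid htn hbound]
  refine (Finset.abs_sum_le_sum_abs _ _).trans (Finset.sum_le_sum fun i _ ↦ ?_)
  rw [← Real.norm_eq_abs]
  refine intervalIntegral.norm_integral_le_of_norm_le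
    (NNReal.coe_le_coe.2 (monotone_stoppedGrid n t i.le_succ)) (ae_of_all volume fun u hu ↦ ?_)
    (hbound.intervalIntegrable _ _)
  have hu0 : 0 ≤ u := (stoppedGrid n t i).coe_nonneg.trans hu.1.le
  have hmesh : (stoppedGrid n t (i + 1) : ℝ) ≤ stoppedGrid n t i + (n : ℝ)⁻¹ := by
    exact_mod_cast stoppedGrid_succ_le n t i
  rw [norm_mul, mul_comm, Real.norm_eq_abs, Real.norm_eq_abs]
  refine mul_le_mul_of_nonneg_right (hε _ ?_ _ (stoppedGrid_le n t _) ?_) (abs_nonneg _)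
  · exact Real.toNNReal_le_iff_le_coe.2
      (hu.2.trans (NNReal.coe_le_coe.2 (stoppedGrid_le n t _)))
  · rw [NNReal.dist_eq, Real.coe_toNNReal _ hu0, abs_sub_comm, abs_of_nonneg] <;>
      linarith [hu.1, hu.2]

lemma tendsto_stieltjesSum {f : ℝ → ℝ} {w : ℝ≥0 → ℝ} (hf : ContDiff ℝ 1 f) (hw : Continuous w)
    (t : ℝ≥0) : Tendsto (stieltjesSum f w · t) atTop (𝓝 (wienerIntegral f w t)) := by
  rw [Metric.tendsto_atTop]
  intro ε hε
  set K := ∫ u in (0 : ℝ)..t, |deriv f u|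
  have hK : 0 ≤ K := intervalIntegral.integral_nonneg t.coe_nonneg fun _ _ ↦ abs_nonneg _
  obtain ⟨δ, hδ, hwδ⟩ := Metric.uniformContinuousOn_iff.1
    ((isCompact_Icc (a := 0) (b := t)).uniformContinuousOn_of_continuous hw.continuousOn)
    (ε / (K + 1)) (by positivity)
  obtain ⟨n₀, hn₀⟩ := exists_nat_gt (max (t : ℝ) δ⁻¹)
  refine ⟨n₀, fun n hn ↦ ?_⟩
  have hn' : max (t : ℝ) δ⁻¹ < n := hn₀.trans_le (by exact_mod_cast hn)
  have htn : (t : ℝ) < n := (le_max_left _ _).trans_lt hn'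
  rw [Real.dist_eq]
  calc |stieltjesSum f w n t - wienerIntegral f w t|
      ≤ ∫ u in (0 : ℝ)..t, ε / (K + 1) * |deriv f u| := by
        refine abs_stieltjesSum_sub_wienerIntegral_le hf hw (by exact_mod_cast htn.le)
          fun u hu v hv huv ↦ ?_
        refine (hwδ u ⟨zero_le, hu⟩ v ⟨zero_le, hv⟩ (huv.trans_lt ?_)).le
        exact inv_lt_of_inv_lt₀ hδ ((le_max_right _ _).trans_lt hn')
    _ = ε * (K / (K + 1)) := by
        rw [intervalIntegral.integral_const_mul, div_mul_eq_mul_div, mul_div_assoc]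
    _ < ε := mul_lt_of_lt_one_right hε ((div_lt_one (by positivity)).2 (by linarith))

lemma wienerIntegral_coe {f : ℝ → ℝ} (hf : ContDiff ℝ 1 f) (t : ℝ≥0) :
    wienerIntegral f (↑) t = ∫ u in (0 : ℝ)..t, f u := by
  have hparts := intervalIntegral.integral_mul_deriv_eq_deriv_mul (u := f) (v := id) (a := 0)
    (b := t) (fun u _ ↦ (hf.differentiable_one u).hasDerivAt) (fun u _ ↦ hasDerivAt_id u)
    (hf.continuous_deriv_one.intervalIntegrable _ _) intervalIntegrable_const
  simp only [mul_one, id] at hparts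
  rw [hparts, wienerIntegral, NNReal.coe_zero]
  congr 1
  refine intervalIntegral.integral_congr fun u hu ↦ ?_
  rw [uIcc_of_le t.coe_nonneg] at hu
  simp only [Real.coe_toNNReal _ hu.1]

lemma exp_mul_sub_eq_add_wienerIntegral {κ θ σ : ℝ} {x w : ℝ≥0 → ℝ} (hx : Continuous x)
    (hw : Continuous w)
    (h : ∀ t : ℝ≥0, x t = x 0 + (∫ s in (0 : ℝ)..t, κ * (θ - x s.toNNReal)) + σ * w t) (t : ℝ≥0) :
    Real.exp (κ * t) * (x t - θ)
      = x 0 - θ + σ * wienerIntegral (fun u ↦ Real.exp (κ * u)) w t := by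
  set y : ℝ → ℝ := fun t ↦ x 0 - θ + ∫ s in (0 : ℝ)..t, κ * (θ - x s.toNNReal)
  have hdrift : Continuous fun s : ℝ ↦ κ * (θ - x s.toNNReal) :=
    (continuous_const.sub (hx.comp continuous_real_toNNReal)).const_mul κ
  have hexp (u : ℝ) : HasDerivAt (fun u ↦ Real.exp (κ * u)) (κ * Real.exp (κ * u)) u := by
    simpa [mul_comm] using ((hasDerivAt_id u).const_mul κ).exp
  have hy (u : ℝ) : HasDerivAt y (κ * (θ - x u.toNNReal)) u :=
    (hdrift.integral_hasStrictDerivAt 0 u).hasDerivAt.const_add _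
  have hyx (s : ℝ≥0) : y s = x s - θ - σ * w s := by rw [h s]; simp only [y]; ring
  have hderiv : ∀ u ∈ uIcc (0 : ℝ) t, HasDerivAt (fun u ↦ Real.exp (κ * u) * y u)
      (-(σ * (κ * Real.exp (κ * u) * w u.toNNReal))) u := fun u hu ↦ by
    rw [uIcc_of_le t.coe_nonneg] at hu
    refine ((hexp u).mul (hy u)).congr_deriv ?_
    have := hyx u.toNNReal
    rw [Real.coe_toNNReal _ hu.1] at this
    rw [this]
    ring
  have hint : Continuous fun u : ℝ ↦ -(σ * (κ * Real.exp (κ * u) * w u.toNNReal)) := by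
    have := hw.comp continuous_real_toNNReal
    fun_prop
  have hFTC := intervalIntegral.integral_eq_sub_of_hasDerivAt hderiv (hint.intervalIntegrable _ _)
  have h0 := hyx 0
  rw [intervalIntegral.integral_neg, intervalIntegral.integral_const_mul, hyx] at hFTC
  simp only [NNReal.coe_zero, mul_zero, Real.exp_zero, one_mul] at hFTC h0
  rw [h0] at hFTC
  simp only [wienerIntegral, (hexp _).deriv, mul_zero, Real.exp_zero, one_mul]
  linear_combination -hFTC

end WienerIntegral

section GaussianProcesses

open Filter Topology

variable {Ω S T : Type*} [MeasurableSpace Ω] {P : Measure Ω}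

lemma isGaussianProcess_of_mem_span {X : T → Ω → ℝ} (hX : IsGaussianProcess X P) {Y : S → Ω → ℝ}
    (hY : ∀ s, Y s ∈ Submodule.span ℝ (range X)) : IsGaussianProcess Y P := by
  refine hX.of_isGaussianProcess fun s ↦ ?_
  obtain ⟨c, hc⟩ := Finsupp.mem_span_range_iff_exists_finsupp.1 (hY s)
  refine ⟨c.support, ∑ i : c.support, c i • .proj i, fun ω ↦ ?_⟩
  rw [← hc, Finsupp.sum, ← Finset.sum_coe_sort]
  simp

lemma hasGaussianLaw_of_mem_span {X : T → Ω → ℝ} (hX : IsGaussianProcess X P) {Y : Ω → ℝ}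
    (hY : Y ∈ Submodule.span ℝ (range X)) : HasGaussianLaw Y P :=
  (isGaussianProcess_of_mem_span hX (Y := fun _ : Unit ↦ Y) fun _ ↦ hY).hasGaussianLaw_eval ()

lemma isGaussianProcess_of_forall_span {X : T → Ω → ℝ}
    (h : ∀ Y ∈ Submodule.span ℝ (range X), HasGaussianLaw Y P) : IsGaussianProcess X P where
  hasGaussianLaw I := by
    classical
    have hX : AEMeasurable (fun ω ↦ I.restrict (X · ω)) P :=
      aemeasurable_pi_lambda _ fun i ↦ (h _ (Submodule.subset_span ⟨i, rfl⟩)).aemeasurable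
    refine ⟨isGaussian_of_map_eq_gaussianReal fun L ↦ ?_⟩
    have hL : (fun ω ↦ L (I.restrict (X · ω))) ∈ Submodule.span ℝ (range X) := by
      have : (fun ω ↦ L (I.restrict (X · ω)))
          = ∑ i : I, L (fun j ↦ if i = j then 1 else 0) • X i := by
        ext ω
        refine ((L : (I → ℝ) →ₗ[ℝ] ℝ).pi_apply_eq_sum_univ _).trans ?_
        simp [mul_comm]
      rw [this]
      exact Submodule.sum_mem _ fun i _ ↦
        Submodule.smul_mem _ _ (Submodule.subset_span ⟨i, rfl⟩)
    exact ⟨_, _, by rw [AEMeasurable.map_map_of_aemeasurable (by fun_prop) hX]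
                    exact (h _ hL).map_eq_gaussianReal⟩

lemma isGaussianProcess_sumElim {X : S → Ω → ℝ} {Y : T → Ω → ℝ} (hX : IsGaussianProcess X P)
    (hY : IsGaussianProcess Y P) (h : IndepFun (fun ω s ↦ X s ω) (fun ω t ↦ Y t ω) P) :
    IsGaussianProcess (Sum.elim X Y) P where
  hasGaussianLaw I := by
    have hind : IndepFun (fun ω ↦ I.toLeft.restrict (X · ω))
        (fun ω ↦ I.toRight.restrict (Y · ω)) P :=
      h.comp (φ := I.toLeft.restrict) (ψ := I.toRight.restrict) (by fun_prop) (by fun_prop)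
    have hpair := hind.hasGaussianLaw (hX.hasGaussianLaw I.toLeft) (hY.hasGaussianLaw I.toRight)
    let L : (I.toLeft → ℝ) × (I.toRight → ℝ) →L[ℝ] I → ℝ := .pi fun
      | ⟨.inl s, hs⟩ => (.proj ⟨s, Finset.mem_toLeft.2 hs⟩ : (I.toLeft → ℝ) →L[ℝ] ℝ).comp
          (.fst ℝ _ _)
      | ⟨.inr t, ht⟩ => (.proj ⟨t, Finset.mem_toRight.2 ht⟩ : (I.toRight → ℝ) →L[ℝ] ℝ).comp
          (.snd ℝ _ _)
    convert! hpair.map L using 2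
    ext ⟨i, hi⟩
    cases i <;> rfl

lemma isGaussianProcess_of_iIndepFun {X : T → Ω → ℝ} (hX : ∀ t, HasGaussianLaw (X t) P)
    (h : iIndepFun X P) : IsGaussianProcess X P where
  hasGaussianLaw I := (h.precomp (g := ((↑) : I → T)) Subtype.val_injective).hasGaussianLaw
    fun i ↦ hX i

lemma isGaussianProcess_add_const {X : T → Ω → ℝ} (hX : IsGaussianProcess X P) (c : T → ℝ) :
    IsGaussianProcess (fun t ω ↦ X t ω + c t) P where
  hasGaussianLaw I := by
    have := (hX.hasGaussianLaw I).isGaussian_map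
    have hmap : P.map (fun ω ↦ I.restrict fun t ↦ X t ω + c t)
        = (P.map fun ω ↦ I.restrict (X · ω)).map (· + I.restrict c) := by
      rw [AEMeasurable.map_map_of_aemeasurable (by fun_prop) (hX.hasGaussianLaw I).aemeasurable]
      rfl
    exact ⟨hmap ▸ inferInstance⟩

variable {Y : ℕ → Ω → ℝ} {Z : Ω → ℝ}

lemma hasLaw_gaussianReal_of_ae_tendsto (hY : ∀ k, HasGaussianLaw (Y k) P)
    (hYZ : ∀ᵐ ω ∂P, Tendsto (Y · ω) atTop (𝓝 (Z ω))) {m v : ℝ}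
    (hm : Tendsto (fun k ↦ P[Y k]) atTop (𝓝 m)) (hv : Tendsto (fun k ↦ Var[Y k; P]) atTop (𝓝 v)) :
    HasLaw Z (gaussianReal m v.toNNReal) P := by
  have := (hY 0).isProbabilityMeasure
  have hZ : AEMeasurable Z P := aemeasurable_of_tendsto_metrizable_ae' (hY · |>.aemeasurable) hYZ
  have := Measure.isProbabilityMeasure_map hZ
  have hv0 : 0 ≤ v := ge_of_tendsto' hv fun k ↦ variance_nonneg _ _
  refine ⟨hZ, Measure.ext_of_charFun (funext fun t ↦ ?_)⟩
  have hlaw := ProbabilityMeasure.tendsto_iff_tendsto_charFun.1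
    (tendstoInDistribution_of_ae_tendsto (hY · |>.aemeasurable) hZ hYZ).tendsto t
  refine tendsto_nhds_unique hlaw ?_
  simp only [ProbabilityMeasure.coe_mk, (hY _).map_eq_gaussianReal, charFun_gaussianReal,
    Real.coe_toNNReal _ hv0, Real.coe_toNNReal _ (variance_nonneg _ _)]
  have hm' := (Complex.continuous_ofReal.tendsto m).comp hm
  have hv' := (Complex.continuous_ofReal.tendsto v).comp hv
  exact ((hm'.const_mul _).mul_const _ |>.sub ((hv'.mul_const _).div_const _)).cexp

lemma variance_eq_of_ae_tendsto (hY : ∀ k, HasGaussianLaw (Y k) P)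
    (hYZ : ∀ᵐ ω ∂P, Tendsto (Y · ω) atTop (𝓝 (Z ω))) {m v : ℝ}
    (hm : Tendsto (fun k ↦ P[Y k]) atTop (𝓝 m)) (hv : Tendsto (fun k ↦ Var[Y k; P]) atTop (𝓝 v)) :
    Var[Z; P] = v := by
  rw [(hasLaw_gaussianReal_of_ae_tendsto hY hYZ hm hv).variance_eq, variance_id_gaussianReal,
    Real.coe_toNNReal _ (ge_of_tendsto' hv fun k ↦ variance_nonneg _ _)]

variable {X : ℕ → T → Ω → ℝ} {Z : T → Ω → ℝ} {m : T → ℝ} {c : T → T → ℝ}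

lemma isGaussianProcess_of_ae_tendsto
    (hX : ∀ k, IsGaussianProcess (X k) P)
    (hXZ : ∀ t, ∀ᵐ ω ∂P, Tendsto (X · t ω) atTop (𝓝 (Z t ω)))
    (hm : ∀ t, Tendsto (fun k ↦ P[X k t]) atTop (𝓝 (m t)))
    (hc : ∀ s t, Tendsto (fun k ↦ cov[X k s, X k t; P]) atTop (𝓝 (c s t))) :
    IsGaussianProcess Z P := by
  have := (hX 0).isProbabilityMeasure
  refine isGaussianProcess_of_forall_span fun V hV ↦ ?_
  obtain ⟨a, rfl⟩ := Finsupp.mem_span_range_iff_exists_finsupp.1 hV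
  simp only [Finsupp.sum]
  have hmem (k : ℕ) (t : T) : MemLp (X k t) 2 P := ((hX k).hasGaussianLaw_eval t).memLp_two
  have hmem' (k : ℕ) (t : T) : MemLp (a t • X k t) 2 P := (hmem k t).const_smul _
  refine (hasLaw_gaussianReal_of_ae_tendsto (Y := fun k ↦ ∑ t ∈ a.support, a t • X k t)
    (m := ∑ t ∈ a.support, a t * m t)
    (v := ∑ s ∈ a.support, ∑ t ∈ a.support, a s * (a t * c s t))
    (fun k ↦ hasGaussianLaw_of_mem_span (hX k) ?_) ?_ ?_ ?_).hasGaussianLaw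
  · exact Submodule.sum_mem _ fun t _ ↦ Submodule.smul_mem _ _ (Submodule.subset_span ⟨t, rfl⟩)
  · filter_upwards [(Finset.eventually_all a.support).2 fun t _ ↦ hXZ t] with ω hω
    simpa using tendsto_finsetSum _ fun t ht ↦ (hω t ht).const_mul (a t)
  · have (k : ℕ) : P[∑ t ∈ a.support, a t • X k t] = ∑ t ∈ a.support, a t * P[X k t] := by
      simp only [Finset.sum_apply, Pi.smul_apply, smul_eq_mul]
      rw [integral_finsetSum _ fun t _ ↦ ((hmem k t).integrable one_le_two).const_mul _]
      simp only [integral_const_mul]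
    simp only [this]
    exact tendsto_finsetSum _ fun t _ ↦ (hm t).const_mul _
  · have (k : ℕ) : Var[∑ t ∈ a.support, a t • X k t; P]
        = ∑ s ∈ a.support, ∑ t ∈ a.support, a s * (a t * cov[X k s, X k t; P]) := by
      rw [variance_sum' fun t _ ↦ hmem' k t]
      exact Finset.sum_congr rfl fun s _ ↦ Finset.sum_congr rfl fun t _ ↦ by
        rw [covariance_smul_left, covariance_smul_right]
    simp only [this]
    exact tendsto_finsetSum _ fun s _ ↦ tendsto_finsetSum _ fun t _ ↦
      ((hc s t).const_mul _).const_mul _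

lemma covariance_eq_of_ae_tendsto (hX : ∀ k, IsGaussianProcess (X k) P)
    (hXZ : ∀ t, ∀ᵐ ω ∂P, Tendsto (X · t ω) atTop (𝓝 (Z t ω)))
    (hm : ∀ t, Tendsto (fun k ↦ P[X k t]) atTop (𝓝 (m t)))
    (hc : ∀ s t, Tendsto (fun k ↦ cov[X k s, X k t; P]) atTop (𝓝 (c s t))) (s t : T) :
    cov[Z s, Z t; P] = c s t := by
  have := (hX 0).isProbabilityMeasure
  have hZ := isGaussianProcess_of_ae_tendsto hX hXZ hm hc
  have hmem (k : ℕ) (t : T) : MemLp (X k t) 2 P := ((hX k).hasGaussianLaw_eval t).memLp_two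
  have hZmem (t : T) : MemLp (Z t) 2 P := (hZ.hasGaussianLaw_eval t).memLp_two
  have hself (t : T) : Tendsto (fun k ↦ Var[X k t; P]) atTop (𝓝 (c t t)) := by
    simpa only [covariance_self (hmem _ t).aemeasurable] using hc t t
  have hvar (t : T) : Var[Z t; P] = c t t :=
    variance_eq_of_ae_tendsto (fun k ↦ (hX k).hasGaussianLaw_eval t) (hXZ t) (hm t) (hself t)
  have hvar_add : Var[Z s + Z t; P] = c s s + 2 * c s t + c t t := by
    refine variance_eq_of_ae_tendsto (Y := fun k ↦ X k s + X k t) (m := m s + m t)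
      (fun k ↦ (hX k).hasGaussianLaw_add) ?_ ?_ ?_
    · filter_upwards [hXZ s, hXZ t] with ω hs ht using hs.add ht
    · simp only [Pi.add_apply, integral_add ((hmem _ s).integrable one_le_two)
        ((hmem _ t).integrable one_le_two)]
      exact (hm s).add (hm t)
    · simp only [variance_add (hmem _ s) (hmem _ t)]
      exact ((hself s).add ((hc s t).const_mul 2)).add (hself t)
  rw [variance_add (hZmem s) (hZmem t), hvar, hvar] at hvar_add
  linarith

end GaussianProcesses

section OrnsteinUhlenbeck

open Filter Topology

lemma stieltjesSum_mem_span {Ω : Type*} (W : ℝ≥0 → Ω → ℝ) (f : ℝ → ℝ) (n : ℕ) (t : ℝ≥0) :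
    (fun ω ↦ stieltjesSum f (W · ω) n t) ∈ Submodule.span ℝ (range W) := by
  have : (fun ω ↦ stieltjesSum f (W · ω) n t) = ∑ i ∈ Finset.range (n ^ 2),
      f (i / n) • (W (stoppedGrid n t (i + 1)) - W (stoppedGrid n t i)) := by
    ext ω
    simp [stieltjesSum]
  rw [this]
  have hW (t : ℝ≥0) : W t ∈ Submodule.span ℝ (range W) := Submodule.subset_span ⟨t, rfl⟩
  exact Submodule.sum_mem _ fun i _ ↦ Submodule.smul_mem _ _ (Submodule.sub_mem _ (hW _) (hW _))

variable {Ω : Type*} [MeasurableSpace Ω] {P : Measure Ω} {κ θ σ : ℝ} {X W : ℝ≥0 → Ω → ℝ}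

lemma integral_stieltjesSum (hW : IsPreBrownianReal W P) (f : ℝ → ℝ) (n : ℕ) (t : ℝ≥0) :
    ∫ ω, stieltjesSum f (W · ω) n t ∂P = 0 := by
  have hint (i : ℕ) : Integrable (fun ω ↦
      f (i / n) * (W (stoppedGrid n t (i + 1)) ω - W (stoppedGrid n t i) ω)) P :=
    ((hW.integrable_eval _).sub (hW.integrable_eval _)).const_mul _
  simp only [stieltjesSum]
  rw [integral_finsetSum _ fun i _ ↦ hint i]
  refine Finset.sum_eq_zero fun i _ ↦ ?_
  rw [integral_const_mul, integral_sub (hW.integrable_eval _) (hW.integrable_eval _),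
    hW.integral_eval, hW.integral_eval, sub_zero, mul_zero]

lemma covariance_stoppedGrid_increments (hW : IsPreBrownianReal W P) (n : ℕ) (s t : ℝ≥0)
    (i j : ℕ) :
    cov[fun ω ↦ W (stoppedGrid n s (i + 1)) ω - W (stoppedGrid n s i) ω,
        fun ω ↦ W (stoppedGrid n t (j + 1)) ω - W (stoppedGrid n t j) ω; P]
      = if i = j then
          (stoppedGrid n (min s t) (i + 1) : ℝ) - stoppedGrid n (min s t) i else 0 := by
  have := hW.isGaussianProcess.isProbabilityMeasure
  have hmem (t : ℝ≥0) : MemLp (W t) 2 P := (hW.isGaussianProcess.hasGaussianLaw_eval t).memLp_two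
  have hmin (i j : ℕ) :
      min (stoppedGrid n s i) (stoppedGrid n t j) = stoppedGrid n (min s t) (min i j) := by
    have : ((min i j : ℕ) / n : ℝ≥0) = min (i / n : ℝ≥0) (j / n) := by
      have hmono : Monotone fun i : ℕ ↦ (i / n : ℝ≥0) := fun a b hab ↦ by simp only; gcongr
      exact hmono.map_min
    rw [stoppedGrid, stoppedGrid, stoppedGrid, min_min_min_comm, this]
  rw [covariance_fun_sub_fun_sub (hmem _) (hmem _) (hmem _) (hmem _)]
  simp only [hW.covariance_eval, hmin]
  rcases lt_trichotomy i j with h | rfl | h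
  · rw [if_neg h.ne, show min (i + 1) (j + 1) = i + 1 by omega, show min (i + 1) j = i + 1 by omega,
      show min i (j + 1) = i by omega, show min i j = i by omega]
    ring
  · simp
  · rw [if_neg h.ne', show min (i + 1) (j + 1) = j + 1 by omega, show min (i + 1) j = j by omega,
      show min i (j + 1) = j + 1 by omega, show min i j = j by omega]
    ring

lemma covariance_stieltjesSum (hW : IsPreBrownianReal W P) (f : ℝ → ℝ) (n : ℕ) (s t : ℝ≥0) :
    cov[fun ω ↦ stieltjesSum f (W · ω) n s, fun ω ↦ stieltjesSum f (W · ω) n t; P]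
      = stieltjesSum (fun u ↦ f u ^ 2) (↑) n (min s t) := by
  have := hW.isGaussianProcess.isProbabilityMeasure
  have hmem (t : ℝ≥0) (i : ℕ) : MemLp (fun ω ↦
      f (i / n) * (W (stoppedGrid n t (i + 1)) ω - W (stoppedGrid n t i) ω)) 2 P :=
    (((hW.isGaussianProcess.hasGaussianLaw_eval _).memLp_two).sub
      (hW.isGaussianProcess.hasGaussianLaw_eval _).memLp_two).const_mul _
  simp only [stieltjesSum]
  rw [covariance_fun_sum_fun_sum' (fun i _ ↦ hmem s i) (fun j _ ↦ hmem t j)]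
  refine Finset.sum_congr rfl fun i hi ↦ ?_
  simp only [covariance_const_mul_left, covariance_const_mul_right,
    covariance_stoppedGrid_increments hW, mul_ite, mul_zero]
  rw [Finset.sum_ite_eq, if_pos hi]
  ring

lemma tendsto_covariance_stieltjesSum (hW : IsPreBrownianReal W P) {f : ℝ → ℝ}
    (hf : ContDiff ℝ 1 f) (s t : ℝ≥0) :
    Tendsto (fun n ↦ cov[fun ω ↦ stieltjesSum f (W · ω) n s,
        fun ω ↦ stieltjesSum f (W · ω) n t; P]) atTop
      (𝓝 (∫ u in (0 : ℝ)..(min s t : ℝ≥0), f u ^ 2)) := by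
  simp only [covariance_stieltjesSum hW]
  rw [← wienerIntegral_coe (hf.pow 2)]
  exact tendsto_stieltjesSum (hf.pow 2) NNReal.continuous_coe _

/-- The approximation of the solution at time `t` of `dx = κ (θ - x) dt + σ dw`, `x 0 = x₀`, in
which the Wiener integral of the variation of constants formula is replaced by its `n`-th
Riemann-Stieltjes sum. -/
noncomputable def ouApprox (κ θ σ x₀ : ℝ) (w : ℝ≥0 → ℝ) (n : ℕ) (t : ℝ≥0) : ℝ :=
  Real.exp (-κ * t) * (x₀ + σ * stieltjesSum (fun u ↦ Real.exp (κ * u)) w n t)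
    + (1 - Real.exp (-κ * t)) * θ

namespace IsOUProcess

lemma ae_tendsto_ouApprox (hX : IsOUProcess κ θ σ X W P) (t : ℝ≥0) :
    ∀ᵐ ω ∂P, Tendsto (ouApprox κ θ σ (X 0 ω) (W · ω) · t) atTop (𝓝 (X t ω)) := by
  filter_upwards [hX.continuous, hX.sde, hX.brownian.cont] with ω hXω hsde hWω
  have hlim := tendsto_stieltjesSum (f := fun u ↦ Real.exp (κ * u)) (by fun_prop) hWω t
  have hsol : X t ω = Real.exp (-κ * t) *
      (X 0 ω + σ * wienerIntegral (fun u ↦ Real.exp (κ * u)) (W · ω) t)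
        + (1 - Real.exp (-κ * t)) * θ := by
    have hexp : Real.exp (-κ * t) * Real.exp (κ * t) = 1 := by
      rw [← Real.exp_add, neg_mul, neg_add_cancel, Real.exp_zero]
    linear_combination Real.exp (-κ * t) * exp_mul_sub_eq_add_wienerIntegral hXω hWω hsde t
      - (X t ω - θ) * hexp
  rw [hsol]
  exact (((hlim.const_mul σ).const_add _).const_mul _).add_const _

lemma isGaussianProcess_ouApprox (hX : IsOUProcess κ θ σ X W P) (n : ℕ) :
    IsGaussianProcess (fun t ω ↦ ouApprox κ θ σ (X 0 ω) (W · ω) n t) P := by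
  have := hX.brownian.isGaussianProcess.isProbabilityMeasure
  have hinit : IsGaussianProcess (fun _ : Unit ↦ X 0) P :=
    isGaussianProcess_of_iIndepFun (fun _ ↦ hX.hasLaw_zero.hasGaussianLaw) .of_subsingleton
  have hjoint : IsGaussianProcess (Sum.elim (fun _ : Unit ↦ X 0) W) P :=
    isGaussianProcess_sumElim hinit hX.brownian.isGaussianProcess
      (hX.indep_zero.comp (φ := fun x (_ : Unit) ↦ x) (by fun_prop) measurable_id)
  refine isGaussianProcess_add_const (isGaussianProcess_of_mem_span hjoint fun t ↦ ?_)
    fun t : ℝ≥0 ↦ (1 - Real.exp (-κ * t)) * θ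
  refine Submodule.smul_mem _ _ (Submodule.add_mem _ (Submodule.subset_span ⟨.inl (), rfl⟩)
    (Submodule.smul_mem _ _ (Submodule.span_mono ?_ (stieltjesSum_mem_span W _ n t))))
  rintro _ ⟨s, rfl⟩
  exact ⟨.inr s, rfl⟩

lemma integral_ouApprox (hX : IsOUProcess κ θ σ X W P) (n : ℕ) (t : ℝ≥0) :
    ∫ ω, ouApprox κ θ σ (X 0 ω) (W · ω) n t ∂P = θ := by
  have := hX.brownian.isGaussianProcess.isProbabilityMeasure
  have hS : Integrable (fun ω ↦ σ * stieltjesSum (fun u ↦ Real.exp (κ * u)) (W · ω) n t) P :=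
    (hasGaussianLaw_of_mem_span hX.brownian.isGaussianProcess
      (stieltjesSum_mem_span W _ n t)).integrable.const_mul σ
  have hX0 : Integrable (X 0) P := hX.hasLaw_zero.hasGaussianLaw.integrable
  have hsum : Integrable (fun ω ↦ Real.exp (-κ * t) *
      (X 0 ω + σ * stieltjesSum (fun u ↦ Real.exp (κ * u)) (W · ω) n t)) P :=
    (hX0.add hS).const_mul _
  simp only [ouApprox]
  rw [integral_add hsum (integrable_const _), integral_const_mul,
    integral_add hX0 hS, integral_const_mul, integral_stieltjesSum hX.brownian.toIsPreBrownianReal,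
    hX.hasLaw_zero.integral_eq, integral_id_gaussianReal, integral_const, probReal_univ, one_smul]
  ring

lemma covariance_ouApprox (hX : IsOUProcess κ θ σ X W P) (n : ℕ) (s t : ℝ≥0) :
    cov[fun ω ↦ ouApprox κ θ σ (X 0 ω) (W · ω) n s,
        fun ω ↦ ouApprox κ θ σ (X 0 ω) (W · ω) n t; P]
      = Real.exp (-κ * s) * (Real.exp (-κ * t) * (Var[X 0; P] + σ ^ 2 *
          cov[fun ω ↦ stieltjesSum (fun u ↦ Real.exp (κ * u)) (W · ω) n s,
            fun ω ↦ stieltjesSum (fun u ↦ Real.exp (κ * u)) (W · ω) n t; P])) := by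
  have := hX.brownian.isGaussianProcess.isProbabilityMeasure
  set S : ℝ≥0 → Ω → ℝ := fun t ω ↦ stieltjesSum (fun u ↦ Real.exp (κ * u)) (W · ω) n t
  have hX0 : MemLp (X 0) 2 P := hX.hasLaw_zero.hasGaussianLaw.memLp_two
  have hSmem (t : ℝ≥0) : MemLp (S t) 2 P := (hasGaussianLaw_of_mem_span
    hX.brownian.isGaussianProcess (stieltjesSum_mem_span W _ n t)).memLp_two
  have hσS (t : ℝ≥0) : MemLp (σ • S t) 2 P := (hSmem t).const_smul σ
  have hsum (t : ℝ≥0) : MemLp (X 0 + σ • S t) 2 P := hX0.add (hσS t)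
  have hint (t : ℝ≥0) :
      Integrable (fun ω ↦ Real.exp (-κ * t) * (X 0 ω + σ * S t ω)) P :=
    ((hsum t).integrable one_le_two).const_mul _
  have hcross (t : ℝ≥0) : cov[X 0, S t; P] = 0 := by
    refine (hX.indep_zero.comp (φ := id)
      (ψ := fun w ↦ stieltjesSum (fun u ↦ Real.exp (κ * u)) w n t) measurable_id ?_)
      |>.covariance_eq_zero hX0 (hSmem t)
    unfold stieltjesSum
    fun_prop
  change cov[fun ω ↦ Real.exp (-κ * s) * (X 0 ω + σ * S s ω) + _,
    fun ω ↦ Real.exp (-κ * t) * (X 0 ω + σ * S t ω) + _; P] = _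
  rw [covariance_add_const_left (hint s), covariance_add_const_right (hint t),
    covariance_const_mul_left, covariance_const_mul_right]
  change _ * (_ * cov[X 0 + σ • S s, X 0 + σ • S t; P]) = _
  rw [covariance_add_left hX0 (hσS s) (hsum t), covariance_add_right hX0 hX0 (hσS t),
    covariance_add_right (hσS s) hX0 (hσS t), covariance_self hX0.aemeasurable]
  simp only [covariance_smul_left, covariance_smul_right, hcross, covariance_comm (S _) (X 0)]
  ring

lemma tendsto_covariance_ouApprox (hX : IsOUProcess κ θ σ X W P) (s t : ℝ≥0) :
    Tendsto (fun n ↦ cov[fun ω ↦ ouApprox κ θ σ (X 0 ω) (W · ω) n s,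
        fun ω ↦ ouApprox κ θ σ (X 0 ω) (W · ω) n t; P]) atTop
      (𝓝 (Real.exp (-κ * s) * (Real.exp (-κ * t) *
        (Var[X 0; P] + σ ^ 2 * ∫ u in (0 : ℝ)..(min s t : ℝ≥0), Real.exp (κ * u) ^ 2)))) := by
  simp only [hX.covariance_ouApprox]
  exact ((((tendsto_covariance_stieltjesSum hX.brownian.toIsPreBrownianReal
    (by fun_prop) s t).const_mul _).const_add _).const_mul _).const_mul _

lemma isGaussianProcess (hX : IsOUProcess κ θ σ X W P) : IsGaussianProcess X P :=
  isGaussianProcess_of_ae_tendsto hX.isGaussianProcess_ouApprox hX.ae_tendsto_ouApprox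
    (fun t ↦ by simp only [hX.integral_ouApprox]; exact tendsto_const_nhds)
    hX.tendsto_covariance_ouApprox

lemma covariance_eq (hX : IsOUProcess κ θ σ X W P) (hκ : 0 < κ) {s t : ℝ≥0} (hst : s ≤ t) :
    cov[X s, X t; P] = σ ^ 2 / (2 * κ) * Real.exp (-κ * (t - s)) := by
  have hvar : Var[X 0; P] = σ ^ 2 / (2 * κ) := by
    rw [hX.hasLaw_zero.variance_eq, variance_id_gaussianReal, Real.coe_toNNReal _ (by positivity)]
  have hint : ∫ u in (0 : ℝ)..s, Real.exp (κ * u) ^ 2 = (Real.exp (2 * κ * s) - 1) / (2 * κ) := by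
    simp only [← Real.exp_nat_mul, Nat.cast_ofNat, ← mul_assoc]
    rw [intervalIntegral.integral_comp_mul_left _ (by positivity : 2 * κ ≠ 0), integral_exp]
    simp [div_eq_inv_mul]
  have hexp : Real.exp (2 * κ * s) * Real.exp (-κ * s) = Real.exp (κ * s) := by
    rw [← Real.exp_add]
    ring_nf
  have hexp' : Real.exp (-κ * (t - s)) = Real.exp (κ * s) * Real.exp (-κ * t) := by
    rw [← Real.exp_add]
    ring_nf
  rw [covariance_eq_of_ae_tendsto hX.isGaussianProcess_ouApprox hX.ae_tendsto_ouApprox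
    (fun t ↦ by simp only [hX.integral_ouApprox]; exact tendsto_const_nhds)
    hX.tendsto_covariance_ouApprox, min_eq_left hst, hvar, hint, hexp']
  linear_combination σ ^ 2 / (2 * κ) * Real.exp (-κ * t) * hexp

end IsOUProcess

end OrnsteinUhlenbeck

section GaussianMutualInformation

variable {Ω α β E : Type*} [MeasurableSpace Ω] [MeasurableSpace α] [MeasurableSpace β]
  [MeasurableSpace E] {P : Measure Ω}

lemma klDiv_withDensity {ν : Measure α} {d : α → ℝ≥0∞} [IsFiniteMeasure ν]
    [IsFiniteMeasure (ν.withDensity d)] (hd : Measurable d)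
    (huniv : ν.withDensity d univ = ν univ)
    (hint : Integrable (fun x ↦ Real.log (d x).toReal) (ν.withDensity d)) :
    InformationTheory.klDiv (ν.withDensity d) ν ≠ ∞ ∧
      (InformationTheory.klDiv (ν.withDensity d) ν).toReal
        = ∫ x, Real.log (d x).toReal ∂(ν.withDensity d) := by
  have hac : ν.withDensity d ≪ ν := withDensity_absolutelyContinuous _ _
  have hllr : llr (ν.withDensity d) ν =ᵐ[ν.withDensity d] fun x ↦ Real.log (d x).toReal := by
    filter_upwards [hac.ae_le (Measure.rnDeriv_withDensity ν hd)] with x hx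
    rw [llr, hx]
  exact ⟨InformationTheory.klDiv_ne_top hac (hint.congr hllr.symm),
    by rw [InformationTheory.toReal_klDiv_of_measure_eq hac huniv, integral_congr_ae hllr]⟩

lemma mutualInfo_of_withDensity [IsProbabilityMeasure P] {U : Ω → α} {V : Ω → β}
    (hU : AEMeasurable U P) (hV : AEMeasurable V P) {d : α × β → ℝ≥0∞} (hd : Measurable d)
    (hjoint : P.map (fun ω ↦ (U ω, V ω)) = ((P.map U).prod (P.map V)).withDensity d)
    (hint : Integrable (fun ω ↦ Real.log (d (U ω, V ω)).toReal) P) :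
    mutualInfo U V P ≠ ∞ ∧
      (mutualInfo U V P).toReal = ∫ ω, Real.log (d (U ω, V ω)).toReal ∂P := by
  have := Measure.isProbabilityMeasure_map hU
  have := Measure.isProbabilityMeasure_map hV
  have hUV : AEMeasurable (fun ω ↦ (U ω, V ω)) P := hU.prodMk hV
  have hprob := Measure.isProbabilityMeasure_map hUV
  have hlog : Measurable fun p ↦ Real.log (d p).toReal := by fun_prop
  rw [← integral_map (f := fun p ↦ Real.log (d p).toReal) hUV hlog.aestronglyMeasurable]
  rw [mutualInfo]
  have hint' := (integrable_map_measure hlog.aestronglyMeasurable hUV).2 hint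
  rw [hjoint] at hprob hint' ⊢
  exact klDiv_withDensity hd (by simp) hint'

section Shear

variable [AddGroup E] [MeasurableAdd₂ E] [MeasurableSub₂ E] {μ : Measure E} [SFinite μ]
  [μ.IsAddRightInvariant] {p q : E → ℝ≥0∞} {L : β → E}

lemma map_shear_prod_withDensity {ν : Measure β} [SFinite ν] (hp : Measurable p)
    (hq : Measurable q) (hq_zero : ∀ x, q x ≠ 0) (hq_top : ∀ x, q x ≠ ∞) (hL : Measurable L) :
    (ν.prod (μ.withDensity p)).map (fun z ↦ (z.2 + L z.1, z.1))
      = ((μ.withDensity q).prod ν).withDensity fun z ↦ p (z.1 - L z.2) / q z.1 := by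
  have hd : Measurable fun z : E × β ↦ p (z.1 - L z.2) / q z.1 := by fun_prop
  have hshear : Measurable fun z : β × E ↦ (z.2 + L z.1, z.1) := by fun_prop
  ext s hs
  have hs' : Measurable (s.indicator (1 : E × β → ℝ≥0∞)) := measurable_one.indicator hs
  rw [withDensity_apply _ hs, ← lintegral_indicator hs,
    lintegral_prod_symm _ (hd.indicator hs).aemeasurable, ← lintegral_indicator_one hs,
    lintegral_map hs' hshear, lintegral_prod _ (by exact (hs'.comp hshear).aemeasurable)]
  refine lintegral_congr fun v ↦ ?_
  rw [lintegral_withDensity_eq_lintegral_mul _ hp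
      (by exact hs'.comp (hshear.comp measurable_prodMk_left)),
    lintegral_withDensity_eq_lintegral_mul _ hq
      (by exact (hd.indicator hs).comp measurable_prodMk_right),
    ← lintegral_sub_right_eq_self _ (L v)]
  refine lintegral_congr fun u ↦ ?_
  by_cases hus : (u, v) ∈ s
  · simp [hus, ENNReal.mul_div_cancel (hq_zero u) (hq_top u)]
  · simp [hus]

lemma map_prodMk_eq_withDensity [IsFiniteMeasure P] {U e : Ω → E} {V : Ω → β} (hp : Measurable p)
    (hq : Measurable q) (hq_zero : ∀ x, q x ≠ 0) (hq_top : ∀ x, q x ≠ ∞) (hL : Measurable L)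
    (hV : AEMeasurable V P) (hU : P.map U = μ.withDensity q) (he : HasLaw e (μ.withDensity p) P)
    (hUe : ∀ ω, U ω = e ω + L (V ω)) (hind : IndepFun V e P) :
    P.map (fun ω ↦ (U ω, V ω))
      = ((P.map U).prod (P.map V)).withDensity fun z ↦ p (z.1 - L z.2) / q z.1 := by
  have hUV : (fun ω ↦ (U ω, V ω)) = (fun z ↦ (z.2 + L z.1, z.1)) ∘ fun ω ↦ (V ω, e ω) := by
    ext ω <;> simp [hUe]
  rw [hU, ← map_shear_prod_withDensity hp hq hq_zero hq_top hL, ← he.map_eq,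
    ← (indepFun_iff_map_prod_eq_prod_map_map hV he.aemeasurable).1 hind, hUV,
    AEMeasurable.map_map_of_aemeasurable (by fun_prop) (hV.prodMk he.aemeasurable)]

end Shear

lemma log_gaussianPDFReal (m : ℝ) {v : ℝ≥0} (hv : v ≠ 0) (x : ℝ) :
    Real.log (gaussianPDFReal m v x)
      = -(1 / 2 * Real.log (2 * Real.pi * v)) - (x - m) ^ 2 / (2 * v) := by
  have h2 : 0 < 2 * Real.pi * v := by positivity
  rw [gaussianPDFReal, Real.log_mul (inv_ne_zero (Real.sqrt_ne_zero'.2 h2)) (Real.exp_ne_zero _),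
    Real.log_exp, Real.log_inv, Real.log_sqrt h2.le]
  ring

section Entropy

variable {Z : Ω → ℝ} {m : ℝ} {v : ℝ≥0}

lemma integrable_log_gaussianPDFReal (hv : v ≠ 0) (hZ : HasLaw Z (gaussianReal m v) P) :
    Integrable (fun ω ↦ Real.log (gaussianPDFReal m v (Z ω))) P := by
  have := hZ.hasGaussianLaw.isProbabilityMeasure
  simp only [log_gaussianPDFReal m hv]
  exact (integrable_const _).sub
    ((hZ.hasGaussianLaw.memLp_two.sub (memLp_const m)).integrable_sq.div_const _)

lemma integral_log_gaussianPDFReal (hv : v ≠ 0) (hZ : HasLaw Z (gaussianReal m v) P) :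
    ∫ ω, Real.log (gaussianPDFReal m v (Z ω)) ∂P
      = -(1 / 2 * Real.log (2 * Real.pi * v)) - 1 / 2 := by
  have := hZ.hasGaussianLaw.isProbabilityMeasure
  have hsq : Integrable (fun ω ↦ (Z ω - m) ^ 2) P :=
    (hZ.hasGaussianLaw.memLp_two.sub (memLp_const m)).integrable_sq
  have hmean : P[Z] = m := by rw [hZ.integral_eq, integral_id_gaussianReal]
  have hvar : ∫ ω, (Z ω - m) ^ 2 ∂P = v := by
    rw [← hmean, ← variance_eq_integral hZ.aemeasurable, hZ.variance_eq, variance_id_gaussianReal]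
  simp only [log_gaussianPDFReal m hv]
  rw [integral_sub (integrable_const _) (hsq.div_const _), integral_div, hvar, integral_const,
    probReal_univ, one_smul]
  field_simp

end Entropy

lemma mutualInfo_of_gaussian_error {U e : Ω → ℝ} {V : Ω → β} {L : β → ℝ} {mu me : ℝ}
    {vu ve : ℝ≥0} (hvu : vu ≠ 0) (hve : ve ≠ 0) (hL : Measurable L) (hV : AEMeasurable V P)
    (hU : HasLaw U (gaussianReal mu vu) P) (he : HasLaw e (gaussianReal me ve) P)
    (hUe : ∀ ω, U ω = e ω + L (V ω)) (hind : IndepFun V e P) :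
    mutualInfo U V P ≠ ∞ ∧ (mutualInfo U V P).toReal = 1 / 2 * Real.log (vu / ve) := by
  have := hU.hasGaussianLaw.isProbabilityMeasure
  have hpu := measurable_gaussianPDF mu vu
  have hpe := measurable_gaussianPDF me ve
  have hlog (ω : Ω) : Real.log (gaussianPDF me ve (U ω - L (V ω)) / gaussianPDF mu vu (U ω)).toReal
      = Real.log (gaussianPDFReal me ve (e ω)) - Real.log (gaussianPDFReal mu vu (U ω)) := by
    rw [ENNReal.toReal_div, toReal_gaussianPDF, toReal_gaussianPDF, Real.log_div
      (gaussianPDFReal_pos _ _ _ hve).ne' (gaussianPDFReal_pos _ _ _ hvu).ne', hUe,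
      add_sub_cancel_right]
  have hint := (integrable_log_gaussianPDFReal hve he).sub (integrable_log_gaussianPDFReal hvu hU)
  have hmi := mutualInfo_of_withDensity hU.aemeasurable hV
    (d := fun z ↦ gaussianPDF me ve (z.1 - L z.2) / gaussianPDF mu vu z.1) (by fun_prop)
    (map_prodMk_eq_withDensity hpe hpu (fun _ ↦ (gaussianPDF_pos mu hvu _).ne')
      (fun _ ↦ gaussianPDF_ne_top) hL hV (gaussianReal_of_var_ne_zero mu hvu ▸ hU.map_eq)
      (gaussianReal_of_var_ne_zero me hve ▸ he) hUe hind)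
    (hint.congr (.of_forall fun ω ↦ (hlog ω).symm))
  refine ⟨hmi.1, hmi.2.trans ?_⟩
  simp only [hlog]
  rw [integral_sub (integrable_log_gaussianPDFReal hve he) (integrable_log_gaussianPDFReal hvu hU),
    integral_log_gaussianPDFReal hve he, integral_log_gaussianPDFReal hvu hU,
    Real.log_mul (by positivity) (NNReal.coe_ne_zero.2 hve),
    Real.log_mul (by positivity) (NNReal.coe_ne_zero.2 hvu),
    Real.log_div (NNReal.coe_ne_zero.2 hvu) (NNReal.coe_ne_zero.2 hve)]
  ring

lemma mutualInfo_of_linear_estimate {ι T : Type*} [Finite ι] {G : T → Ω → ℝ}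
    (hG : IsGaussianProcess G P) {U p : Ω → ℝ} {V : ι → Ω → ℝ}
    (hU : U ∈ Submodule.span ℝ (range G)) (hV : ∀ i, V i ∈ Submodule.span ℝ (range G))
    (hp : p ∈ Submodule.span ℝ (range V)) (horth : ∀ i, cov[V i, U - p; P] = 0)
    (hvar : 0 < Var[U - p; P]) :
    mutualInfo U (fun ω i ↦ V i ω) P ≠ ∞ ∧
      (mutualInfo U (fun ω i ↦ V i ω) P).toReal = 1 / 2 * Real.log (Var[U; P] / Var[U - p; P]) := by
  cases nonempty_fintype ι
  have hpG : p ∈ Submodule.span ℝ (range G) :=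
    Submodule.span_le.2 (range_subset_iff.2 hV) hp
  have heG : U - p ∈ Submodule.span ℝ (range G) := Submodule.sub_mem _ hU hpG
  have hind : IndepFun (fun ω i ↦ V i ω) (U - p) P := by
    have hVe : IsGaussianProcess (Sum.elim V fun _ : Unit ↦ U - p) P :=
      isGaussianProcess_of_mem_span hG (by rintro (i | _); exacts [hV i, heG])
    exact (hVe.indepFun_of_covariance_eq_zero
      (fun i ↦ (hasGaussianLaw_of_mem_span hG (hV i)).aemeasurable)
      (fun _ ↦ (hasGaussianLaw_of_mem_span hG heG).aemeasurable) fun i _ ↦ horth i).comp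
        measurable_id (measurable_pi_apply ())
  obtain ⟨c, rfl⟩ := (Submodule.mem_span_range_iff_exists_fun ℝ).1 hp
  have hUlaw := hasGaussianLaw_of_mem_span hG hU
  have helaw := hasGaussianLaw_of_mem_span hG heG
  have hplaw := hasGaussianLaw_of_mem_span hG hpG
  have hVmeas : AEMeasurable (fun ω i ↦ V i ω) P :=
    aemeasurable_pi_lambda _ fun i ↦ (hasGaussianLaw_of_mem_span hG (hV i)).aemeasurable
  have hsum : ∑ i, c i • V i = (fun v : ι → ℝ ↦ ∑ i, c i * v i) ∘ fun ω i ↦ V i ω := by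
    ext ω; simp
  have hle : Var[U - ∑ i, c i • V i; P] ≤ Var[U; P] := by
    have hind' : IndepFun (∑ i, c i • V i) (U - ∑ i, c i • V i) P := by
      nth_rw 1 [hsum]
      exact hind.comp (by fun_prop) measurable_id
    have hadd := hind'.variance_add hplaw.memLp_two helaw.memLp_two
    rw [add_sub_cancel] at hadd
    linarith [variance_nonneg (∑ i, c i • V i) P]
  have hmi := mutualInfo_of_gaussian_error (L := fun v ↦ ∑ i, c i * v i)
    (Real.toNNReal_pos.2 (hvar.trans_le hle)).ne' (Real.toNNReal_pos.2 hvar).ne' (by fun_prop)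
    hVmeas ⟨hUlaw.aemeasurable, hUlaw.map_eq_gaussianReal⟩
    ⟨helaw.aemeasurable, helaw.map_eq_gaussianReal⟩ (fun ω ↦ by simp) hind
  rwa [Real.coe_toNNReal _ (variance_nonneg _ _), Real.coe_toNNReal _ (variance_nonneg _ _)] at hmi

end GaussianMutualInformation

section LinearFiltering

variable {K M : Type*} [Field K] [AddCommGroup M] [Module K M] {B : LinearMap.BilinForm K M}

/-- `p` is the linear estimate of `x` from the observations in `S`: the orthogonal projection of
`x` on the span of `S` with respect to the form `B`, which plays the role of the covariance. -/
structure IsLinearEstimate (B : LinearMap.BilinForm K M) (S : Set M) (x p : M) : Prop where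
  mem_span : p ∈ Submodule.span K S
  orthogonal : ∀ y ∈ S, B (x - p) y = 0

lemma bilinForm_add_self_of_orthogonal (hB : B.IsSymm) {x y : M} (hxy : B x y = 0) :
    B (x + y) (x + y) = B x x + B y y := by
  have hyx : B y x = 0 := by rw [hB.eq, hxy]
  simp [hxy, hyx]

namespace IsLinearEstimate

variable {S : Set M} {x p z u : M} {a r : K}

lemma orthogonal_of_mem_span (hp : IsLinearEstimate B S x p) {y : M}
    (hy : y ∈ Submodule.span K S) : B (x - p) y = 0 :=
  LinearMap.eqOn_span (f := B (x - p)) (g := 0) hp.orthogonal hy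

lemma apply_error_right (hp : IsLinearEstimate B S x p) : B (x - p) x = B (x - p) (x - p) := by
  rw [map_sub (B (x - p)) x p, hp.orthogonal_of_mem_span hp.mem_span, sub_zero]

lemma zero (hx : ∀ y ∈ S, B x y = 0) : IsLinearEstimate B S x 0 :=
  ⟨zero_mem _, by simpa only [sub_zero]⟩

lemma predict (hp : IsLinearEstimate B S x p) (hu : ∀ y ∈ S, B (u - a • x) y = 0) :
    IsLinearEstimate B S u (a • p) where
  mem_span := Submodule.smul_mem _ a hp.mem_span
  orthogonal y hy := by
    have hdecomp : u - a • p = (u - a • x) + a • (x - p) := by module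
    rw [hdecomp, map_add, LinearMap.add_apply, hu y hy, map_smul, LinearMap.smul_apply,
      hp.orthogonal y hy, smul_zero, add_zero]

lemma predict_error (hB : B.IsSymm) (hp : IsLinearEstimate B S x p)
    (hu : ∀ y ∈ S, B (u - a • x) y = 0) (hux : B (u - a • x) x = 0) :
    B (u - a • p) (u - a • p) = B u u - a ^ 2 * B x x + a ^ 2 * B (x - p) (x - p) := by
  have hup : B (u - a • x) p = 0 :=
    LinearMap.eqOn_span (f := B (u - a • x)) (g := 0) hu hp.mem_span
  have herror := bilinForm_add_self_of_orthogonal hB (x := u - a • x) (y := a • (x - p))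
    (by rw [map_smul, map_sub (B _) x p, hux, hup, sub_zero, smul_zero])
  have hsignal := bilinForm_add_self_of_orthogonal hB (x := u - a • x) (y := a • x)
    (by rw [map_smul, hux, smul_zero])
  rw [show u - a • x + a • (x - p) = u - a • p by module] at herror
  rw [sub_add_cancel] at hsignal
  rw [herror, hsignal]
  simp only [map_smul, LinearMap.smul_apply, smul_eq_mul]
  ring

lemma update (hp : IsLinearEstimate B S x p) (hzS : ∀ y ∈ S, B z y = 0) (hzx : B z x = 0)
    (hez : B (x - p) z = 0) (hzz : B z z = r) (hqr : B (x - p) (x - p) + r ≠ 0) :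
    IsLinearEstimate B (insert (x + z) S) x
      (p + (B (x - p) (x - p) / (B (x - p) (x - p) + r)) • (x + z - p)) := by
  set q := B (x - p) (x - p) with hq
  have hp' : p ∈ Submodule.span K (insert (x + z) S) :=
    Submodule.span_mono (subset_insert _ _) hp.mem_span
  have hxz : x + z ∈ Submodule.span K (insert (x + z) S) :=
    Submodule.subset_span (mem_insert _ _)
  refine ⟨add_mem hp' (Submodule.smul_mem _ _ (sub_mem hxz hp')), fun y hy ↦ ?_⟩
  have herror : x - (p + (q / (q + r)) • (x + z - p))
      = (1 - q / (q + r)) • (x - p) - (q / (q + r)) • z := by module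
  rw [herror, map_sub, LinearMap.sub_apply, map_smul, map_smul, LinearMap.smul_apply,
    LinearMap.smul_apply, smul_eq_mul, smul_eq_mul]
  rcases hy with rfl | hy
  · rw [map_add, map_add, hp.apply_error_right, ← hq, hez, hzx, hzz]
    field_simp
    ring
  · rw [hp.orthogonal y hy, hzS y hy, mul_zero, mul_zero, sub_zero]

lemma update_error (hB : B.IsSymm) (hez : B (x - p) z = 0) (hzz : B z z = r)
    (hqr : B (x - p) (x - p) + r ≠ 0) :
    let p' := p + (B (x - p) (x - p) / (B (x - p) (x - p) + r)) • (x + z - p)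
    B (x - p') (x - p') = B (x - p) (x - p) * r / (B (x - p) (x - p) + r) := by
  intro p'
  set q := B (x - p) (x - p) with hq
  have herror : x - p' = (1 - q / (q + r)) • (x - p) + (-(q / (q + r))) • z := by module
  rw [herror, bilinForm_add_self_of_orthogonal hB (by
    rw [map_smul, map_smul, LinearMap.smul_apply, hez, smul_zero, smul_zero])]
  simp only [map_smul, LinearMap.smul_apply, smul_eq_mul, hzz, ← hq]
  field_simp
  ring

end IsLinearEstimate

/-- The error variance in the prediction of the `k`-th term of an autoregressive sequence of
variance `s` with one-step correlations `ρ` from its earlier terms, when these are observed with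
white noise of variance `r` (Kalman filter). -/
def predictionVariance (s r : K) (ρ : ℕ → K) : ℕ → K
  | 0 => s
  | k + 1 => (1 - ρ k ^ 2) * s
      + ρ k ^ 2 * (predictionVariance s r ρ k * r / (predictionVariance s r ρ k + r))

lemma predictionVariance_mul {c : K} (hc : c ≠ 0) (s r : K) (ρ : ℕ → K) (k : ℕ) :
    predictionVariance (c * s) (c * r) ρ k = c * predictionVariance s r ρ k := by
  induction k with
  | zero => rfl
  | succ k ih =>
    simp only [predictionVariance, ih]
    rw [← mul_add c, mul_mul_mul_comm, mul_assoc c c, mul_div_mul_left _ _ hc]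
    ring

variable [LinearOrder K] [IsStrictOrderedRing K]

lemma predictionVariance_pos {s r : K} {ρ : ℕ → K} (hs : 0 < s) (hr : 0 < r)
    (hρ : ∀ k, ρ k ^ 2 ≤ 1) (k : ℕ) : 0 < predictionVariance s r ρ k := by
  induction k with
  | zero => exact hs
  | succ k ih =>
    have hfilter : 0 < predictionVariance s r ρ k * r / (predictionVariance s r ρ k + r) := by
      positivity
    rcases (hρ k).lt_or_eq with h | h
    · exact add_pos_of_pos_of_nonneg (mul_pos (sub_pos.2 h) hs) (by positivity)
    · simpa [predictionVariance, h]

lemma le_predictionVariance_succ {s r : K} {ρ : ℕ → K} (hs : 0 < s) (hr : 0 < r)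
    (hρ : ∀ k, ρ k ^ 2 ≤ 1) (k : ℕ) :
    (1 - ρ k ^ 2) * s ≤ predictionVariance s r ρ (k + 1) := by
  have hpos := predictionVariance_pos hs hr hρ k
  exact le_add_of_nonneg_right (by positivity)

lemma predictionVariance_succ_le {s r : K} {ρ : ℕ → K} (hs : 0 < s) (hr : 0 < r)
    (hρ : ∀ k, ρ k ^ 2 ≤ 1) (k : ℕ) :
    predictionVariance s r ρ (k + 1) ≤ (1 - ρ k ^ 2) * s + ρ k ^ 2 * r := by
  have hpos := predictionVariance_pos hs hr hρ k
  have hfilter : predictionVariance s r ρ k * r / (predictionVariance s r ρ k + r) ≤ r := by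
    rw [mul_div_right_comm]
    exact mul_le_of_le_one_left hr.le (div_le_one_of_le₀ (by linarith) (by linarith))
  exact add_le_add_right (mul_le_mul_of_nonneg_left hfilter (sq_nonneg _)) _

lemma exists_isLinearEstimate (hB : B.IsSymm) {x z : ℕ → M} {ρ : ℕ → K} {s r : K} (hs : 0 < s)
    (hr : 0 < r) (hρ : ∀ k, ρ k ^ 2 ≤ 1) (hxx : ∀ k, B (x k) (x k) = s)
    (hmarkov : ∀ k, ∀ j ≤ k, B (x (k + 1) - ρ k • x k) (x j) = 0)
    (hzx : ∀ i j, B (z i) (x j) = 0) (hz : ∀ i, B (z i) (z i) = r)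
    (hzz : ∀ i j, i ≠ j → B (z i) (z j) = 0) (k : ℕ) :
    ∃ p, IsLinearEstimate B ((fun j ↦ x j + z j) '' Iio k) (x k) p ∧
      B (x k - p) (x k - p) = predictionVariance s r ρ k := by
  induction k with
  | zero => exact ⟨0, .zero (by simp), by rw [sub_zero, hxx, predictionVariance]⟩
  | succ k ih =>
    obtain ⟨p, hp, hq⟩ := ih
    have hxz (i j : ℕ) : B (x i) (z j) = 0 := by rw [hB.eq, hzx]
    have hzS : ∀ y ∈ (fun j ↦ x j + z j) '' Iio k, B (z k) y = 0 := by
      rintro _ ⟨j, hj, rfl⟩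
      rw [map_add, hzx, hzz k j (mem_Iio.1 hj).ne', add_zero]
    have hzp : B (z k) p = 0 := LinearMap.eqOn_span (f := B (z k)) (g := 0) hzS hp.mem_span
    have hez : B (x k - p) (z k) = 0 := by rw [hB.eq, map_sub, hzx, hzp, sub_zero]
    have hqr : B (x k - p) (x k - p) + r ≠ 0 := by
      rw [hq]
      exact (add_pos (predictionVariance_pos hs hr hρ k) hr).ne'
    have hupdate := hp.update hzS (hzx k k) hez (hz k) hqr
    have hS : (fun j ↦ x j + z j) '' Iio (k + 1)
        = insert (x k + z k) ((fun j ↦ x j + z j) '' Iio k) := by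
      rw [← Order.succ_eq_add_one, Order.Iio_succ_eq_insert, image_insert_eq]
    have hinnovation : ∀ y ∈ insert (x k + z k) ((fun j ↦ x j + z j) '' Iio k),
        B (x (k + 1) - ρ k • x k) y = 0 := by
      rw [← hS]
      rintro _ ⟨j, hj, rfl⟩
      rw [map_add, hmarkov k j (Nat.lt_succ_iff.1 hj), map_sub, map_smul, LinearMap.sub_apply,
        LinearMap.smul_apply, hxz, hxz, smul_zero, sub_zero, add_zero]
    refine ⟨_, hS ▸ hupdate.predict hinnovation, ?_⟩
    rw [hupdate.predict_error hB hinnovation (hmarkov k k le_rfl), hxx, hxx,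
      IsLinearEstimate.update_error hB hez (hz k) hqr, hq, predictionVariance]
    ring

end LinearFiltering

section ValueOfInformation

variable {Ω : Type*} [MeasurableSpace Ω]

/-- The real random variables with a finite second moment. -/
def squareIntegrable (P : Measure Ω) : Submodule ℝ (Ω → ℝ) where
  carrier := {f | MemLp f 2 P}
  add_mem' hf hg := MemLp.add hf hg
  zero_mem' := MemLp.zero
  smul_mem' c _ hf := MemLp.const_smul hf c

/-- The covariance as a bilinear form. -/
noncomputable def covarianceForm (P : Measure Ω) [IsFiniteMeasure P] :
    LinearMap.BilinForm ℝ (squareIntegrable P) :=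
  LinearMap.mk₂ ℝ (fun f g ↦ cov[(f : Ω → ℝ), (g : Ω → ℝ); P])
    (fun f g h ↦ covariance_add_left f.2 g.2 h.2)
    (fun c _ _ ↦ covariance_smul_left c)
    (fun f g h ↦ covariance_add_right f.2 g.2 h.2)
    (fun c _ _ ↦ covariance_smul_right c)

lemma covarianceForm_apply (P : Measure Ω) [IsFiniteMeasure P] (f g : squareIntegrable P) :
    covarianceForm P f g = cov[(f : Ω → ℝ), (g : Ω → ℝ); P] := rfl

lemma covarianceForm_self (P : Measure Ω) [IsFiniteMeasure P] (f : squareIntegrable P) :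
    covarianceForm P f f = Var[(f : Ω → ℝ); P] :=
  covariance_self f.2.aemeasurable

lemma isSymm_covarianceForm (P : Measure Ω) [IsFiniteMeasure P] : (covarianceForm P).IsSymm :=
  ⟨fun _ _ ↦ covariance_comm _ _⟩

variable {P : Measure Ω} {κ θ σ σn : ℝ} {X W N : ℝ≥0 → Ω → ℝ} {t t' : ℕ → ℝ≥0}

namespace IsChannelNoise

lemma isGaussianProcess (hN : IsChannelNoise σn t' X N P) :
    IsGaussianProcess (fun i ↦ N (t' i)) P :=
  isGaussianProcess_of_iIndepFun (fun i ↦ (hN.hasLaw i).hasGaussianLaw) hN.iIndep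

lemma covariance_eq_zero (hN : IsChannelNoise σn t' X N P) {i j : ℕ} (hij : i ≠ j) :
    cov[N (t' i), N (t' j); P] = 0 :=
  (hN.iIndep.indepFun hij).covariance_eq_zero (hN.hasLaw i).hasGaussianLaw.memLp_two
    (hN.hasLaw j).hasGaussianLaw.memLp_two

lemma variance_eq (hN : IsChannelNoise σn t' X N P) (i : ℕ) : Var[N (t' i); P] = σn ^ 2 := by
  rw [(hN.hasLaw i).variance_eq, variance_id_gaussianReal, Real.coe_toNNReal _ (sq_nonneg _)]

end IsChannelNoise

lemma exp_neg_mul_sub_sq_le_one (hκ : 0 < κ) {r s : ℝ≥0} (hrs : r ≤ s) :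
    Real.exp (-κ * (s - r)) ^ 2 ≤ 1 := by
  have hnonneg : 0 ≤ κ * (s - r : ℝ) := mul_nonneg hκ.le (sub_nonneg.2 hrs)
  exact pow_le_one₀ (Real.exp_pos _).le (Real.exp_le_one_iff.2 (by linarith))

namespace IsOUProcess

lemma memLp_two (hX : IsOUProcess κ θ σ X W P) (s : ℝ≥0) : MemLp (X s) 2 P :=
  (hX.isGaussianProcess.hasGaussianLaw_eval s).memLp_two

lemma variance_eq (hX : IsOUProcess κ θ σ X W P) (hκ : 0 < κ) (s : ℝ≥0) :
    Var[X s; P] = σ ^ 2 / (2 * κ) := by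
  rw [← covariance_self (hX.memLp_two s).aemeasurable, hX.covariance_eq hκ le_rfl, sub_self,
    mul_zero, Real.exp_zero, mul_one]

lemma covariance_innovation (hX : IsOUProcess κ θ σ X W P) (hκ : 0 < κ) {r s u : ℝ≥0}
    (hrs : r ≤ s) (hsu : s ≤ u) :
    cov[X u - Real.exp (-κ * (u - s)) • X s, X r; P] = 0 := by
  have := hX.isGaussianProcess.isProbabilityMeasure
  rw [covariance_sub_left (hX.memLp_two u) ((hX.memLp_two s).const_smul _) (hX.memLp_two r),
    covariance_smul_left, covariance_comm (X u), covariance_comm (X s),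
    hX.covariance_eq hκ (hrs.trans hsu), hX.covariance_eq hκ hrs, mul_left_comm, ← Real.exp_add]
  ring_nf

lemma covariance_noise (hX : IsOUProcess κ θ σ X W P) (hN : IsChannelNoise σn t' X N P) (s : ℝ≥0)
    (i : ℕ) : cov[N (t' i), X s; P] = 0 :=
  (hN.indep.symm.comp (measurable_pi_apply i) (measurable_pi_apply s)).covariance_eq_zero
    (hN.hasLaw i).hasGaussianLaw.memLp_two (hX.memLp_two s)

lemma exists_linear_estimate (hX : IsOUProcess κ θ σ X W P) (hκ : 0 < κ) (hσ : σ ≠ 0)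
    (hσn : σn ≠ 0) (hN : IsChannelNoise σn t' X N P) {T : ℕ → ℝ≥0} (hT : Monotone T) {i : ℕ → ℕ}
    (hi : i.Injective) (m : ℕ) :
    ∃ p ∈ Submodule.span ℝ (range fun j : Fin m ↦ X (T j) + N (t' (i j))),
      (∀ j : Fin m, cov[X (T j) + N (t' (i j)), X (T m) - p; P] = 0) ∧
      Var[X (T m) - p; P] = predictionVariance (σ ^ 2 / (2 * κ)) (σn ^ 2)
        (fun k ↦ Real.exp (-κ * (T (k + 1) - T k))) m := by
  have := hX.isGaussianProcess.isProbabilityMeasure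
  let x (j : ℕ) : squareIntegrable P := ⟨X (T j), hX.memLp_two _⟩
  let z (j : ℕ) : squareIntegrable P := ⟨N (t' (i j)), (hN.hasLaw _).hasGaussianLaw.memLp_two⟩
  have hmarkov (k j : ℕ) (hj : j ≤ k) :
      covarianceForm P (x (k + 1) - Real.exp (-κ * (T (k + 1) - T k)) • x k) (x j) = 0 := by
    rw [covarianceForm_apply, Submodule.coe_sub, Submodule.coe_smul]
    exact hX.covariance_innovation hκ (hT hj) (hT k.le_succ)
  obtain ⟨p, hp, hp_var⟩ := exists_isLinearEstimate (isSymm_covarianceForm P) (x := x) (z := z)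
    (s := σ ^ 2 / (2 * κ)) (r := σn ^ 2) (by positivity) (by positivity)
    (fun k ↦ exp_neg_mul_sub_sq_le_one hκ (hT k.le_succ))
    (fun k ↦ (covarianceForm_self P _).trans (hX.variance_eq hκ _)) hmarkov
    (fun _ _ ↦ (covarianceForm_apply P _ _).trans (hX.covariance_noise hN _ _))
    (fun _ ↦ (covarianceForm_self P _).trans (hN.variance_eq _))
    (fun _ _ hne ↦ (covarianceForm_apply P _ _).trans (hN.covariance_eq_zero (hi.ne hne))) m
  rw [covarianceForm_self, Submodule.coe_sub] at hp_var
  refine ⟨p, Submodule.span_mono ?_ (Submodule.apply_mem_span_image_of_mem_span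
    (squareIntegrable P).subtype hp.mem_span), fun j ↦ ?_, hp_var⟩
  · rintro _ ⟨_, ⟨j, hj, rfl⟩, rfl⟩
    exact ⟨⟨j, hj⟩, rfl⟩
  · have horth := hp.orthogonal _ ⟨j, j.2, rfl⟩
    rw [covarianceForm_apply, covariance_comm, Submodule.coe_add, Submodule.coe_sub] at horth
    exact horth

lemma mutualInfo_observations (hX : IsOUProcess κ θ σ X W P) (hκ : 0 < κ) (hσ : σ ≠ 0)
    (hσn : σn ≠ 0) (hN : IsChannelNoise σn t' X N P) {T : ℕ → ℝ≥0} (hT : Monotone T) {i : ℕ → ℕ}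
    (hi : i.Injective) (m : ℕ) :
    mutualInfo (X (T m)) (fun ω (j : Fin m) ↦ X (T j) ω + N (t' (i j)) ω) P ≠ ∞ ∧
    (mutualInfo (X (T m)) (fun ω (j : Fin m) ↦ X (T j) ω + N (t' (i j)) ω) P).toReal
      = 1 / 2 * Real.log (σ ^ 2 / (2 * κ) / predictionVariance (σ ^ 2 / (2 * κ)) (σn ^ 2)
          (fun k ↦ Real.exp (-κ * (T (k + 1) - T k))) m) := by
  obtain ⟨p, hp, horth, hvar⟩ := hX.exists_linear_estimate hκ hσ hσn hN hT hi m
  have hjoint : IsGaussianProcess (Sum.elim X fun i ↦ N (t' i)) P :=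
    isGaussianProcess_sumElim hX.isGaussianProcess hN.isGaussianProcess hN.indep
  have hsignal (s : ℝ≥0) : X s ∈ Submodule.span ℝ (range (Sum.elim X fun i ↦ N (t' i))) :=
    Submodule.subset_span ⟨.inl s, rfl⟩
  have hnoise (i : ℕ) : N (t' i) ∈ Submodule.span ℝ (range (Sum.elim X fun i ↦ N (t' i))) :=
    Submodule.subset_span ⟨.inr i, rfl⟩
  have hpos : 0 < Var[X (T m) - p; P] := by
    rw [hvar]
    exact predictionVariance_pos (by positivity) (by positivity)
      (fun k ↦ exp_neg_mul_sub_sq_le_one hκ (hT k.le_succ)) m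
  have hmi := mutualInfo_of_linear_estimate hjoint (hsignal (T m))
    (fun j : Fin m ↦ add_mem (hsignal (T j)) (hnoise (i j))) hp horth hpos
  rwa [hvar, hX.variance_eq hκ] at hmi

end IsOUProcess

/-- The increasing sequence of the sampling times of the `m` latest observations up to index `n`,
continued by the time `s` at which the process is to be estimated. -/
def latestTimes (t : ℕ → ℝ≥0) (m n : ℕ) (s : ℝ≥0) (j : ℕ) : ℝ≥0 :=
  if j < m then t (n - m + 1 + j) else s

lemma monotone_latestTimes (ht : Monotone t) {m n : ℕ} {s : ℝ≥0} (hmn : m ≤ n) (hs : t n ≤ s) :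
    Monotone (latestTimes t m n s) := by
  refine monotone_nat_of_le_succ fun j ↦ ?_
  unfold latestTimes
  split_ifs with h₁ h₂ h₂
  · exact ht (by omega)
  · exact (ht (by omega)).trans hs
  · omega
  · rfl

/-- The correlations of the process at consecutive terms of `latestTimes t m n s`. -/
noncomputable def latestCorrelations (κ : ℝ) (t : ℕ → ℝ≥0) (m n : ℕ) (s : ℝ≥0) (k : ℕ) : ℝ :=
  Real.exp (-κ * (latestTimes t m n s (k + 1) - latestTimes t m n s k))

lemma IsOUProcess.valueOfInformation_eq (hX : IsOUProcess κ θ σ X W P) (hκ : 0 < κ) (hσ : σ ≠ 0)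
    (hσn : σn ≠ 0) (hN : IsChannelNoise σn t' X N P) (ht : Monotone t) {m n : ℕ} {s : ℝ≥0}
    (hmn : m ≤ n) (hs : t n ≤ s) :
    valueOfInformation t t' X N P m n s ≠ ∞ ∧
    (valueOfInformation t t' X N P m n s).toReal = 1 / 2 * Real.log
      (1 / predictionVariance 1 (1 / snr κ σ σn) (latestCorrelations κ t m n s) m) := by
  have hs2 : σ ^ 2 / (2 * κ) ≠ 0 := by positivity
  have hnoise : σ ^ 2 / (2 * κ) * (1 / snr κ σ σn) = σn ^ 2 := by
    rw [snr]
    field_simp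
  have hscale : predictionVariance (σ ^ 2 / (2 * κ)) (σn ^ 2) (latestCorrelations κ t m n s) m
      = σ ^ 2 / (2 * κ)
        * predictionVariance 1 (1 / snr κ σ σn) (latestCorrelations κ t m n s) m := by
    rw [← predictionVariance_mul hs2, mul_one, hnoise]
  have hmi := hX.mutualInfo_observations hκ hσ hσn hN (monotone_latestTimes ht hmn hs)
    (add_right_injective (n - m + 1)) m
  have hobs : (fun ω (j : Fin m) ↦ observation t t' X N (n - m + 1 + j) ω)
      = fun ω (j : Fin m) ↦ X (latestTimes t m n s j) ω + N (t' (n - m + 1 + j)) ω := by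
    ext ω j
    rw [observation, latestTimes, if_pos j.2]
  have hlast : latestTimes t m n s m = s := if_neg m.lt_irrefl
  rw [valueOfInformation, hobs, ← mul_div_mul_left (1 : ℝ) (predictionVariance _ _ _ _) hs2,
    mul_one, ← hscale]
  rwa [hlast] at hmi

end ValueOfInformation

section HighSNR

lemma abs_log_sub_log_le {a b : ℝ} (ha : 1 ≤ a) (hb : 1 ≤ b) :
    |Real.log a - Real.log b| ≤ |a - b| := by
  wlog hab : b ≤ a generalizing a b
  · rw [abs_sub_comm, abs_sub_comm a]
    exact this hb ha (le_of_not_ge hab)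
  have hb0 : 0 < b := by linarith
  have ha0 : 0 < a := by linarith
  rw [abs_of_nonneg (sub_nonneg.2 (Real.log_le_log hb0 hab)), abs_of_nonneg (sub_nonneg.2 hab),
    ← Real.log_div ha0.ne' hb0.ne']
  calc Real.log (a / b) ≤ a / b - 1 := Real.log_le_sub_one_of_pos (div_pos ha0 hb0)
    _ = (a - b) / b := by rw [sub_div, div_self hb0.ne']
    _ ≤ a - b := div_le_self (sub_nonneg.2 hab) hb

lemma abs_mul_div_add_sub_le {d q η : ℝ} (hd : 0 < d) (hη : 0 ≤ η) (hdq : d ≤ q)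
    (hqd : q ≤ d + η) :
    |q * η / (q + η) - (η - η ^ 2 / d)| ≤ 2 * η ^ 3 / d ^ 2 := by
  have hqη : 0 < q + η := by linarith
  have hexcess : 0 ≤ q + η - d := by linarith
  have hdiff : q * η / (q + η) - (η - η ^ 2 / d) = η ^ 2 * (q + η - d) / (d * (q + η)) := by
    field_simp
    ring
  rw [hdiff, abs_of_nonneg (by positivity)]
  calc η ^ 2 * (q + η - d) / (d * (q + η)) ≤ η ^ 2 * (2 * η) / (d * d) := by
        gcongr <;> linarith
    _ = 2 * η ^ 3 / d ^ 2 := by ring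

lemma log_one_div_eq_markovTerm_sub {κ τ : ℝ} (hκτ : 0 < κ * τ) {u : ℝ} (hu : 0 ≤ u) :
    1 / 2 * Real.log (1 / (1 - Real.exp (-κ * τ) ^ 2 + Real.exp (-κ * τ) ^ 2 * u))
      = markovTerm κ τ - 1 / 2 * Real.log (1 + 1 / (Real.exp (2 * κ * τ) - 1) * u) := by
  have hsq : Real.exp (-κ * τ) ^ 2 = Real.exp (-2 * κ * τ) := by
    rw [← Real.exp_nat_mul]
    ring_nf
  have hinv : Real.exp (-2 * κ * τ) = (Real.exp (2 * κ * τ))⁻¹ := by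
    rw [← Real.exp_neg]
    ring_nf
  have hE : 1 < Real.exp (2 * κ * τ) := Real.one_lt_exp_iff.2 (by linarith)
  rw [markovTerm, hsq, hinv]
  set E := Real.exp (2 * κ * τ)
  have hE' : 0 < E - 1 := sub_pos.2 hE
  have hmarkov : 0 < 1 - E⁻¹ := sub_pos.2 (inv_lt_one_of_one_lt₀ hE)
  have hfactor : 1 - E⁻¹ + E⁻¹ * u = (1 - E⁻¹) * (1 + 1 / (E - 1) * u) := by
    field_simp
  rw [hfactor, one_div (_ * _), Real.log_inv, Real.log_mul hmarkov.ne' (by positivity),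
    one_div (1 - E⁻¹), Real.log_inv]
  ring

lemma abs_sub_log_sub_sub_log_le (a : ℝ) {c u w : ℝ} (hc : 0 ≤ c) (hu : 0 ≤ u) (hw : 0 ≤ w) :
    |a - 1 / 2 * Real.log (1 + c * u) - (a - 1 / 2 * Real.log (1 + c * w))|
      ≤ 1 / 2 * (c * |u - w|) := by
  rw [sub_sub_sub_cancel_left, ← mul_sub, abs_mul, abs_sub_comm, abs_of_pos one_half_pos]
  calc 1 / 2 * |Real.log (1 + c * u) - Real.log (1 + c * w)|
      ≤ 1 / 2 * |1 + c * u - (1 + c * w)| :=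
        mul_le_mul_of_nonneg_left (abs_log_sub_log_le (le_add_of_nonneg_right (mul_nonneg hc hu))
          (le_add_of_nonneg_right (mul_nonneg hc hw))) one_half_pos.le
    _ = 1 / 2 * (c * |u - w|) := by
        rw [add_sub_add_left_eq_sub, ← mul_sub, abs_mul, abs_of_nonneg hc]

lemma abs_log_sub_highSNR_le {κ τ ρ γ q : ℝ} (hκτ : 0 < κ * τ) (hρ : ρ ^ 2 < 1)
    (hγ : 1 / (1 - ρ ^ 2) ≤ γ) (hq : 1 - ρ ^ 2 ≤ q) (hq' : q ≤ 1 - ρ ^ 2 + ρ ^ 2 * (1 / γ)) :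
    |1 / 2 * Real.log (1 / (1 - Real.exp (-κ * τ) ^ 2
          + Real.exp (-κ * τ) ^ 2 * (q * (1 / γ) / (q + 1 / γ))))
        - (markovTerm κ τ - highSNRCorrection κ τ ρ γ)|
      ≤ 1 / (Real.exp (2 * κ * τ) - 1) / (1 - ρ ^ 2) ^ 2 / γ ^ 3 := by
  have hd : 0 < 1 - ρ ^ 2 := sub_pos.2 hρ
  have hγ0 : 0 < γ := (one_div_pos.2 hd).trans_le hγ
  have hη : 0 < 1 / γ := one_div_pos.2 hγ0
  have hc : 0 < 1 / (Real.exp (2 * κ * τ) - 1) :=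
    one_div_pos.2 (sub_pos.2 (Real.one_lt_exp_iff.2 (by linarith)))
  have hηd : 1 / γ ≤ 1 - ρ ^ 2 := (one_div_le hd hγ0).1 hγ
  have hexpand : 1 / γ - 1 / ((1 - ρ ^ 2) * γ ^ 2) = 1 / γ - (1 / γ) ^ 2 / (1 - ρ ^ 2) := by
    field_simp
  have hq0 : 0 < q := hd.trans_le hq
  rw [log_one_div_eq_markovTerm_sub hκτ (by positivity), highSNRCorrection, hexpand]
  set d := 1 - ρ ^ 2
  set η := 1 / γ with hη_def
  set c := 1 / (Real.exp (2 * κ * τ) - 1)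
  have herror := abs_mul_div_add_sub_le hd hη.le hq
    (hq'.trans (add_le_add_right (mul_le_of_le_one_left hη.le hρ.le) _))
  have hw : 0 ≤ η - η ^ 2 / d := by
    rw [sub_nonneg, div_le_iff₀ hd, sq]
    exact mul_le_mul_of_nonneg_left hηd hη.le
  calc |markovTerm κ τ - 1 / 2 * Real.log (1 + c * (q * η / (q + η)))
          - (markovTerm κ τ - 1 / 2 * Real.log (1 + c * (η - η ^ 2 / d)))|
      ≤ 1 / 2 * (c * |q * η / (q + η) - (η - η ^ 2 / d)|) :=
        abs_sub_log_sub_sub_log_le _ hc.le (by positivity) hw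
    _ ≤ 1 / 2 * (c * (2 * η ^ 3 / d ^ 2)) := by gcongr
    _ = c / d ^ 2 / γ ^ 3 := by
        rw [hη_def]
        field_simp

end HighSNR

section TwoRecentSamples

variable {κ : ℝ}

lemma latestCorrelations_last (t : ℕ → ℝ≥0) {k n : ℕ} (hkn : k + 1 ≤ n) (s : ℝ≥0) :
    latestCorrelations κ t (k + 1) n s k = Real.exp (-κ * (s - t n)) := by
  have hindex : n - (k + 1) + 1 + k = n := by omega
  rw [latestCorrelations, latestTimes, latestTimes, if_neg (lt_irrefl _), if_pos k.lt_succ_self,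
    hindex]

lemma latestCorrelations_penultimate (t : ℕ → ℝ≥0) {k n : ℕ} (hkn : k + 2 ≤ n) (s : ℝ≥0) :
    latestCorrelations κ t (k + 2) n s k = Real.exp (-κ * (t n - t (n - 1))) := by
  have hindex : n - (k + 2) + 1 + (k + 1) = n := by omega
  have hindex' : n - (k + 2) + 1 + k = n - 1 := by omega
  rw [latestCorrelations, latestTimes, latestTimes, if_pos (by omega), if_pos (by omega), hindex,
    hindex']

end TwoRecentSamples

theorem corollary2_general (κ : ℝ) (hκ : 0 < κ) (δ : ℝ) (hδ : 0 < δ) (τ : ℝ) (hτ : 0 < τ) :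
    ∃ γ₀ C : ℝ, 0 < γ₀ ∧ 0 ≤ C ∧
      ∀ θ σ σn : ℝ, γ₀ ≤ snr κ σ σn →
      ∀ (Ω : Type*) [MeasurableSpace Ω] (P : Measure Ω) (X W N : ℝ≥0 → Ω → ℝ) (t t' : ℕ → ℝ≥0),
        Monotone t → IsOUProcess κ θ σ X W P → IsChannelNoise σn t' X N P →
      ∀ (m n : ℕ) (s : ℝ≥0), 2 ≤ m → m ≤ n → (t n : ℝ) - t (n - 1) = δ → (s : ℝ) - t n = τ →
        valueOfInformation t t' X N P m n s ≠ ∞ ∧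
        |(valueOfInformation t t' X N P m n s).toReal -
            (markovTerm κ τ - highSNRCorrection κ τ (Real.exp (-κ * δ)) (snr κ σ σn))|
          ≤ C / snr κ σ σn ^ 3 := by
  have hρ : Real.exp (-κ * δ) ^ 2 < 1 :=
    pow_lt_one₀ (Real.exp_pos _).le (Real.exp_lt_one_iff.2 (by nlinarith)) two_ne_zero
  have hd : 0 < 1 - Real.exp (-κ * δ) ^ 2 := sub_pos.2 hρ
  have hE : 0 < Real.exp (2 * κ * τ) - 1 := sub_pos.2 (Real.one_lt_exp_iff.2 (by positivity))
  refine ⟨1 / (1 - Real.exp (-κ * δ) ^ 2),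
    1 / (Real.exp (2 * κ * τ) - 1) / (1 - Real.exp (-κ * δ) ^ 2) ^ 2, by positivity,
    by positivity, ?_⟩
  intro θ σ σn hγ Ω _ P X W N t t' ht hX hN m n s hm hmn hn hs
  have hγ0 : 0 < snr κ σ σn := (one_div_pos.2 hd).trans_le hγ
  have hσ : σ ≠ 0 := by rintro rfl; simp [snr] at hγ0
  have hσn : σn ≠ 0 := by rintro rfl; simp [snr] at hγ0
  have hts : t n ≤ s := NNReal.coe_le_coe.1 (by linarith)
  obtain ⟨hfin, hvalue⟩ := hX.valueOfInformation_eq hκ hσ hσn hN ht hmn hts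
  obtain ⟨k, rfl⟩ := Nat.exists_eq_add_of_le' hm
  have hr : 0 < 1 / snr κ σ σn := one_div_pos.2 hγ0
  have hcorr (j : ℕ) : latestCorrelations κ t (k + 2) n s j ^ 2 ≤ 1 :=
    exp_neg_mul_sub_sq_le_one hκ (monotone_latestTimes ht hmn hts j.le_succ)
  have hlower := le_predictionVariance_succ one_pos hr hcorr k
  have hupper := predictionVariance_succ_le one_pos hr hcorr k
  rw [latestCorrelations_penultimate t hmn, hn, mul_one] at hlower hupper
  rw [predictionVariance, latestCorrelations_last t hmn, hs, mul_one] at hvalue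
  rw [hvalue]
  exact ⟨hfin, abs_log_sub_highSNR_le (mul_pos hκ hτ) hρ hγ hlower hupper⟩

lemma monotone_uniformTime (Δt : ℝ≥0) : Monotone (uniformTime Δt) := fun _ _ hij ↦
  mul_le_mul_left (Nat.cast_le.2 hij) Δt

lemma uniformTime_sub_uniformTime_pred (Δt : ℝ≥0) {n : ℕ} (hn : n ≠ 0) :
    (uniformTime Δt n : ℝ) - uniformTime Δt (n - 1) = Δt := by
  obtain ⟨k, rfl⟩ := Nat.exists_eq_succ_of_ne_zero hn
  simp only [uniformTime, Nat.succ_eq_add_one, add_tsub_cancel_right]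
  push_cast
  ring

theorem corollary2 (κ : ℝ) (hκ : 0 < κ) (Δt : ℝ≥0) (hΔt : 0 < Δt) (τ : ℝ) (hτ : 0 < τ) :
    ∃ γ₀ C : ℝ, 0 < γ₀ ∧ 0 ≤ C ∧
      ∀ (θ σ σn : ℝ), 0 < σ → 0 < σn → γ₀ ≤ snr κ σ σn →
      ∀ (Ω : Type*) [MeasurableSpace Ω] (P : Measure Ω) [IsProbabilityMeasure P]
        (X W N : ℝ≥0 → Ω → ℝ) (t' : ℕ → ℝ≥0),
        IsOUProcess κ θ σ X W P →
        (∀ i, uniformTime Δt i < t' i) →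
        IsChannelNoise σn t' X N P →
      ∀ (m n : ℕ) (t : ℝ≥0), 2 ≤ m → m ≤ n → t' n < t → (t : ℝ) - uniformTime Δt n = τ →
        valueOfInformation (uniformTime Δt) t' X N P m n t ≠ ∞ ∧
        |(valueOfInformation (uniformTime Δt) t' X N P m n t).toReal -
            (markovTerm κ τ - highSNRCorrection κ τ (Real.exp (-κ * Δt)) (snr κ σ σn))|
          ≤ C / snr κ σ σn ^ 3 := by
  obtain ⟨γ₀, C, hγ₀, hC, hbound⟩ := corollary2_general κ hκ Δt hΔt τ hτ
  exact ⟨γ₀, C, hγ₀, hC, fun θ σ σn _ _ hγ Ω _ P _ X W N t' hX _ hN m n t hm hmn _ ↦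
    hbound θ σ σn hγ Ω P X W N _ t' (monotone_uniformTime Δt) hX hN m n t hm hmn
      (uniformTime_sub_uniformTime_pred Δt (by omega))⟩
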